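/- Let $A$ be a finite alphabet with $|A|\ge 2$, and let $\theta$ be an automorphism or an anti-automorphism of $A^*$, that is, a bijection $A^*\to A^*$ with $\theta(uv)=\theta(u)\theta(v)$ for all $u,v$, or with $\theta(uv)=\theta(v)\theta(u)$ for all $u,v$. Let $\underline\theta=\{(w,\theta(w)): w\in A^*,\ \theta(w)\ne w\}$ be its anti-reflexive restriction and $\widehat\theta=\{(w,\theta(w)): w\in A^*\}\cup\{(w,w): w\in A^*\}$ its reflexive closure. A set $X\subseteq A^*$ is a code if $x_1\cdots x_n=y_1\cdots y_p$ with all $x_i,y_j\in X$ implies $n=p$ and $x_i=y_i$ for all $i$. For a relation $\tau\subseteq A^*\times A^*$ let $\underline\tau=\{(w,w')\in\tau: w\neq w'\}$; $X$ is $\tau$-independent if $\tau(X)\cap X=\emptyset$. A code is a maximal $\tau$-independent code if it is $\tau$-independent and is not strictly contained in another $\tau$-independent code. $X$ satisfies Condition (c3) with respect to $\tau$ if it is a maximal $\underline\tau$-independent code (note that $\underline{(\widehat\theta)}=\underline\theta$). $X$ is complete if every word of $A^*$ is a factor of some word of $X^*$. Finally $\mu(X)=\sum_{w\in X}|A|^{-|w|}$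 is the uniform Bernoulli measure. Then the following holds. (i) For every regular code $X\subseteq A^*$, $X$ is complete if and only if $\mu(X)=1$. If moreover $X$ is $\underline\theta$-independent, then the following three conditions are equivalent: $X$ is a maximal $\underline\theta$-independent code; $X$ is complete; $\mu(X)=1$. (ii) There is an algorithm which, given (a finite automaton recognizing) a regular code $X\subseteq A^*$, decides whether $X$ satisfies Condition (c3) with respect to $\widehat\theta$. (iii) Every regular $\underline\theta$-independent code $X\subseteq A^*$ is contained in a maximal $\underline\theta$-independent code. -/

import Mathlib

open scoped Computability ENNReal

/-- A bijection `θ` of `A*` with `θ(uv) = θ(u)θ(v)`. -/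
def IsAutomorphism {A : Type*} (θ : List A → List A) : Prop :=
  Function.Bijective θ ∧ ∀ u v : List A, θ (u ++ v) = θ u ++ θ v

/-- A bijection `θ` of `A*` with `θ(uv) = θ(v)θ(u)`. -/
def IsAntiAutomorphism {A : Type*} (θ : List A → List A) : Prop :=
  Function.Bijective θ ∧ ∀ u v : List A, θ (u ++ v) = θ v ++ θ u

/-- The reflexive closure of a word relation. -/
def reflClosure {A : Type*} (τ : SetRel (List A) (List A)) : SetRel (List A) (List A) :=
  τ ∪ SetRel.id

/-- The anti-reflexive restriction of a word relation. -/
def antiReflRestr {A : Type*} (τ : SetRel (List A) (List A)) : SetRel (List A) (List A) :=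
  τ \ SetRel.id

/-- `X` is `τ`-independent: `τ(X) ∩ X = ∅`. -/
def IsIndependent {A : Type*} (τ : SetRel (List A) (List A)) (X : Set (List A)) : Prop :=
  τ.image X ∩ X = ∅

/-- `X` is a variable-length code: words have at most one factorization over `X`. -/
def IsCode {A : Type*} (X : Set (List A)) : Prop :=
  ∀ xs ys : List (List A), (∀ x ∈ xs, x ∈ X) → (∀ y ∈ ys, y ∈ X) →
    xs.flatten = ys.flatten → xs = ys

/-- `X` is complete: every word is a factor of some word of `X*`. -/
def IsCompleteSet {A : Type*} (X : Language A) : Prop :=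
  ∀ w : List A, ∃ y ∈ X∗, w <:+: y

/-- `X` is a maximal element (for inclusion) of the family of `τ`-independent codes. -/
def IsMaximalIndependentCode {A : Type*} (τ : SetRel (List A) (List A)) (X : Set (List A)) :
    Prop :=
  Maximal (fun Y : Set (List A) => IsCode Y ∧ IsIndependent τ Y) X

/-- Condition (c3) for the word relation `τ`: `X` is maximal in the family of the codes that
are independent with respect to the anti-reflexive restriction of `τ`. -/
def CondC3 {A : Type*} (τ : SetRel (List A) (List A)) (X : Set (List A)) : Prop :=
  IsMaximalIndependentCode (antiReflRestr τ) X

/-- The uniform Bernoulli measure: each letter has measure `1 / |A|`, a word has the product of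
the measures of its letters, and a set of words has the sum of the measures of its elements. -/
noncomputable def uniformMeasure {A : Type*} [Fintype A] (X : Set (List A)) : ℝ≥0∞ :=
  ∑' w : X, (w.1.map fun _ => (Fintype.card A : ℝ≥0∞)⁻¹).prod

/-- A finite description of a finite automaton whose states are natural numbers: the list of
its transitions `(p, a, q)`, the list of its initial states, and the list of its terminal states.
This is the input on which decision procedures work. -/
abbrev AutomatonCode (A : Type*) := List (ℕ × A × ℕ) × List ℕ × List ℕ

/-- The nondeterministic automaton that is described. -/
def AutomatonCode.toNFA {A : Type*} (D : AutomatonCode A) : NFA A ℕ where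
  step p a := {q | (p, a, q) ∈ D.1}
  start := {i | i ∈ D.2.1}
  accept := {t | t ∈ D.2.2}

/-- The regular set that is described, i.e. the behavior of the automaton. -/
def AutomatonCode.behavior {A : Type*} (D : AutomatonCode A) : Language A :=
  D.toNFA.accepts

/-- Every described set is regular. -/
theorem AutomatonCode.behavior_isRegular {A : Type*} (D : AutomatonCode A) :
    D.behavior.IsRegular := by
  rw [Language.isRegular_iff_finite_range_leftQuotient]
  let F : Set ℕ := {q | q ∈ D.2.1 ++ D.1.map fun e => e.2.2}
  have hF : F.Finite := List.finite_toSet _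
  refine (hF.finite_subsets.image D.toNFA.acceptsFrom).subset ?_
  rintro _ ⟨w, rfl⟩
  refine ⟨D.toNFA.evalFrom D.toNFA.start w, ?_, ?_⟩
  · rcases List.eq_nil_or_concat w with rfl | ⟨v, a, rfl⟩
    · intro q hq
      exact List.mem_append_left _ hq
    · intro q hq
      rw [List.concat_eq_append, NFA.evalFrom_append, NFA.evalFrom_singleton,
        NFA.mem_stepSet] at hq
      obtain ⟨p, -, hp⟩ := hq
      exact List.mem_append_right _ (List.mem_map.2 ⟨_, hp, rfl⟩)
  · ext x
    simp only [Language.leftQuotient, AutomatonCode.behavior, NFA.accepts_eq_acceptsFrom_start]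
    change _ ↔ w ++ x ∈ D.toNFA.acceptsFrom D.toNFA.start
    rw [NFA.mem_acceptsFrom, NFA.mem_acceptsFrom, NFA.evalFrom_append]

/-- Over a finite alphabet every regular set has a description. -/
theorem AutomatonCode.exists_behavior_eq {A : Type*} [Finite A] {X : Language A}
    (hX : X.IsRegular) : ∃ D : AutomatonCode A, D.behavior = X := by
  classical
  obtain ⟨σ, _, M, rfl⟩ := hX
  have := Fintype.ofFinite A
  let e := Fintype.equivFin σ
  let N := DFA.reindex e M
  let D : AutomatonCode A := (((Finset.univ : Finset (Fin (Fintype.card σ) × A)).toList.map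
    fun p => ((p.1 : ℕ), p.2, (N.step p.1 p.2 : ℕ))), [(N.start : ℕ)],
    ((Finset.univ.filter (fun q : Fin (Fintype.card σ) => q ∈ N.accept)).toList.map Fin.val))
  refine ⟨D, ?_⟩
  rw [← DFA.accepts_reindex (g := e) (M := M)]
  have key : ∀ (w : List A) (s : Fin (Fintype.card σ)),
      D.toNFA.evalFrom {(s : ℕ)} w = {(N.evalFrom s w : ℕ)} := by
    intro w
    induction w with
    | nil => intro s; simp
    | cons a w ih =>
      intro s
      have : D.toNFA.stepSet {(s : ℕ)} a = {(N.step s a : ℕ)} := by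
        ext q
        simp [D, AutomatonCode.toNFA, NFA.stepSet, Fin.val_inj, eq_comm]
      rw [NFA.evalFrom_cons, this, ih, DFA.evalFrom_cons]
  ext w
  have hs : D.toNFA.start = {(N.start : ℕ)} := by
    ext; simp [D, AutomatonCode.toNFA]
  rw [AutomatonCode.behavior, NFA.mem_accepts, hs, key, DFA.mem_accepts]
  change _ ↔ N.eval w ∈ N.accept
  simp [D, AutomatonCode.toNFA, Fin.val_inj, DFA.eval]

/-! Kraft–McMillan gives `μ(X) ≤ 1` for every code, and each word has positive measure. So a code of
measure 1 has no proper extension to a code, and it is maximal among the codes independent for any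
relation under which it is independent.

A regular complete `X` has `μ(X) ≥ 1`. If `μ(X) < 1`, then `μ(X∗)` is bounded by a convergent
geometric series. A finite automaton for `X∗` covers the nonempty words by finitely many sets `{w |
u w v ∈ X∗}`, each of finite measure, although `μ(A*) = ∞`.

A maximal independent code is complete. If `w` is a factor of no word of `X∗`, it can be put inside
an unbordered word `y` such that `X ∪ {y}` is still a code (`exists_isCode_insert`). Letting `y`
also contain the image and the preimage of `w` under `θ` keeps `θ(y)` and the preimage of `y` out of
`X`, so independence survives. With `θ = id` independence is vacuous, and the same argument shows
that a code of measure 1 is complete.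

Thus (c3) amounts to independence together with completeness, each of which is reduced to
reachability in finite graphs built primitive recursively from the automaton. Independence uses that
`θ` acts letter by letter, up to reversal. The extension in (iii) comes from Zorn's lemma. -/

/-! ### Runs of automata and an automaton for the generated submonoid -/

section Runs

variable {A S : Type*}

/-- `Runs T p w q`: the transitions in `T` lead from `p` to `q` along the word `w`. -/
def Runs (T : List (S × A × S)) : S → List A → S → Prop
  | p, [], q => p = q
  | p, a :: w, q => ∃ r, (p, a, r) ∈ T ∧ Runs T r w q

@[simp] theorem runs_nil {T : List (S × A × S)} {p q : S} : Runs T p [] q ↔ p = q := Iff.rfl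

@[simp] theorem runs_cons {T : List (S × A × S)} {p q : S} {a : A} {w : List A} :
    Runs T p (a :: w) q ↔ ∃ r, (p, a, r) ∈ T ∧ Runs T r w q := Iff.rfl

theorem runs_append {T : List (S × A × S)} {u v : List A} {p q : S} :
    Runs T p (u ++ v) q ↔ ∃ r, Runs T p u r ∧ Runs T r v q := by
  induction u generalizing p with
  | nil => simp
  | cons a u ih =>
    simp only [List.cons_append, runs_cons, ih]
    exact ⟨fun ⟨r, h, s, hs, hv⟩ => ⟨s, ⟨r, h, hs⟩, hv⟩,
      fun ⟨s, ⟨r, h, hs⟩, hv⟩ => ⟨r, h, s, hs, hv⟩⟩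

theorem Runs.mono {T T' : List (S × A × S)} (h : T ⊆ T') {w : List A} {p q : S}
    (hr : Runs T p w q) : Runs T' p w q := by
  induction w generalizing p with
  | nil => exact hr
  | cons a w ih =>
    obtain ⟨r, hT, hr⟩ := hr
    exact ⟨r, h hT, ih hr⟩

theorem AutomatonCode.mem_evalFrom_iff {D : AutomatonCode A} {w : List A} {s : Set ℕ} {q : ℕ} :
    q ∈ D.toNFA.evalFrom s w ↔ ∃ p ∈ s, Runs D.1 p w q := by
  induction w generalizing s with
  | nil => simp
  | cons a w ih =>
    rw [NFA.evalFrom_cons, ih]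
    simp only [NFA.mem_stepSet, runs_cons]
    exact ⟨fun ⟨r, ⟨p, hp, h⟩, hr⟩ => ⟨p, hp, r, h, hr⟩,
      fun ⟨p, hp, r, h, hr⟩ => ⟨r, ⟨p, hp, h⟩, hr⟩⟩

theorem AutomatonCode.mem_behavior_iff {D : AutomatonCode A} {w : List A} :
    w ∈ D.behavior ↔ ∃ p ∈ D.2.1, ∃ q ∈ D.2.2, Runs D.1 p w q := by
  rw [AutomatonCode.behavior, NFA.mem_accepts]
  simp only [AutomatonCode.mem_evalFrom_iff]
  exact ⟨fun ⟨q, hq, p, hp, h⟩ => ⟨p, hp, q, hq, h⟩, fun ⟨p, hp, q, hq, h⟩ => ⟨q, hq, p, hp, h⟩⟩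

/-- The transitions of an automaton for the submonoid generated by a described set: every
transition that enters a terminal state is doubled by transitions to the initial states. -/
def starTrans (D : AutomatonCode A) : List (ℕ × A × ℕ) :=
  D.1 ++ (D.1.filter fun e => e.2.2 ∈ D.2.2).flatMap fun e => D.2.1.map fun i => (e.1, e.2.1, i)

theorem mem_starTrans {D : AutomatonCode A} {p q : ℕ} {a : A} :
    (p, a, q) ∈ starTrans D ↔
      (p, a, q) ∈ D.1 ∨ (q ∈ D.2.1 ∧ ∃ t ∈ D.2.2, (p, a, t) ∈ D.1) := by
  simp only [starTrans, List.mem_append, List.mem_flatMap, List.mem_filter, List.mem_map,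
    decide_eq_true_eq, Prod.mk.injEq, Prod.exists]
  constructor
  · rintro (h | ⟨p', a', t, ⟨h, ht⟩, i, hi, rfl, rfl, rfl⟩)
    · exact .inl h
    · exact .inr ⟨hi, t, ht, h⟩
  · rintro (h | ⟨hi, t, ht, h⟩)
    · exact .inl h
    · exact .inr ⟨p, a, t, ⟨h, ht⟩, q, hi, rfl, rfl, rfl⟩

/-- The start `p` is arbitrary because `x` is the rest of a factor already being read. A redirected
transition finishes that factor and begins the next one. -/
theorem exists_of_runs_starTrans {D : AutomatonCode A} {w : List A} {p t : ℕ} (ht : t ∈ D.2.2)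
    (h : Runs (starTrans D) p w t) :
    ∃ x y, w = x ++ y ∧ (∃ t' ∈ D.2.2, Runs D.1 p x t') ∧ y ∈ D.behavior∗ := by
  induction w generalizing p with
  | nil => exact ⟨[], [], rfl, ⟨t, ht, h⟩, Language.nil_mem_kstar _⟩
  | cons a w ih =>
    obtain ⟨r, hT, hr⟩ := h
    obtain ⟨x, y, rfl, ⟨t', ht', hx⟩, hy⟩ := ih hr
    rcases mem_starTrans.1 hT with h | ⟨hi, s, hs, h⟩
    · exact ⟨a :: x, y, rfl, ⟨t', ht', r, h, hx⟩, hy⟩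
    · refine ⟨[a], x ++ y, rfl, ⟨s, hs, s, h, rfl⟩, ?_⟩
      obtain ⟨L, rfl, hL⟩ := Language.mem_kstar.1 hy
      refine Language.mem_kstar.2 ⟨x :: L, rfl, ?_⟩
      simpa using ⟨AutomatonCode.mem_behavior_iff.2 ⟨r, hi, t', ht', hx⟩, hL⟩

theorem mem_kstar_of_runs_starTrans {D : AutomatonCode A} {w : List A} {i t : ℕ}
    (hi : i ∈ D.2.1) (ht : t ∈ D.2.2) (h : Runs (starTrans D) i w t) : w ∈ D.behavior∗ := by
  obtain ⟨x, y, rfl, ⟨t', ht', hx⟩, hy⟩ := exists_of_runs_starTrans ht h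
  obtain ⟨L, rfl, hL⟩ := Language.mem_kstar.1 hy
  refine Language.mem_kstar.2 ⟨x :: L, rfl, ?_⟩
  simpa using ⟨AutomatonCode.mem_behavior_iff.2 ⟨i, hi, t', ht', hx⟩, hL⟩

theorem exists_runs_starTrans {D : AutomatonCode A} {w : List A} (hw : w ∈ D.behavior∗)
    (hne : w ≠ []) : ∃ i ∈ D.2.1, ∃ t ∈ D.2.2, Runs (starTrans D) i w t := by
  have hsub : D.1 ⊆ starTrans D := fun e he => List.mem_append_left _ he
  obtain ⟨L, rfl, hL⟩ := Language.mem_kstar.1 hw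
  clear hw
  induction L with
  | nil => exact absurd rfl hne
  | cons x L ih =>
    simp only [List.forall_mem_cons] at hL
    rw [List.flatten_cons] at hne ⊢
    by_cases hx : x = []
    · subst hx
      exact ih hL.2 (by simpa only [List.nil_append] using hne)
    obtain ⟨i, hi, t, ht, hr⟩ := AutomatonCode.mem_behavior_iff.1 hL.1
    by_cases hL' : L.flatten = []
    · rw [hL', List.append_nil]
      exact ⟨i, hi, t, ht, hr.mono hsub⟩
    obtain ⟨j, hj, s, hs, hr'⟩ := ih hL.2 hL'
    refine ⟨i, hi, s, hs, runs_append.2 ⟨j, ?_, hr'⟩⟩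
    -- The last transition over `x` enters a terminal state, so its doubled copy enters the initial
    -- state `j`, where the run over the remaining factors begins.
    obtain ⟨x, a, rfl⟩ := List.eq_nil_or_concat x |>.resolve_left hx
    rw [List.concat_eq_append, runs_append] at hr ⊢
    obtain ⟨r, h₁, r', h₂, rfl⟩ := hr
    exact ⟨r, h₁.mono hsub, j, mem_starTrans.2 (.inr ⟨hj, r', ht, h₂⟩), rfl⟩

/-- The state `p` lies on a run from an initial to a terminal state. -/
def IsTrim (T : List (S × A × S)) (I F : List S) (p : S) : Prop :=
  (∃ i ∈ I, ∃ u, Runs T i u p) ∧ ∃ t ∈ F, ∃ v, Runs T p v t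

theorem exists_isInfix_of_runs_starTrans {D : AutomatonCode A} {w : List A} {p q : ℕ}
    (hp : IsTrim (starTrans D) D.2.1 D.2.2 p) (hq : IsTrim (starTrans D) D.2.1 D.2.2 q)
    (h : Runs (starTrans D) p w q) : ∃ y ∈ D.behavior∗, w <:+: y := by
  obtain ⟨⟨i, hi, u, hu⟩, -⟩ := hp
  obtain ⟨-, t, ht, v, hv⟩ := hq
  exact ⟨u ++ w ++ v, mem_kstar_of_runs_starTrans hi ht
    (runs_append.2 ⟨q, runs_append.2 ⟨p, hu, h⟩, hv⟩), u, v, rfl⟩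

theorem exists_runs_starTrans_of_isInfix {D : AutomatonCode A} {w y : List A} (hw : w ≠ [])
    (hy : y ∈ D.behavior∗) (h : w <:+: y) :
    ∃ p q, IsTrim (starTrans D) D.2.1 D.2.2 p ∧ IsTrim (starTrans D) D.2.1 D.2.2 q ∧
      Runs (starTrans D) p w q := by
  obtain ⟨u, v, rfl⟩ := h
  obtain ⟨i, hi, t, ht, hr⟩ := exists_runs_starTrans hy (by simp [hw])
  obtain ⟨q, hq, hv⟩ := runs_append.1 hr
  obtain ⟨p, hu, hw⟩ := runs_append.1 hq
  exact ⟨p, q, ⟨⟨i, hi, u, hu⟩, t, ht, _, runs_append.2 ⟨q, hw, hv⟩⟩,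
    ⟨⟨i, hi, _, runs_append.2 ⟨p, hu, hw⟩⟩, t, ht, v, hv⟩, hw⟩

/-- The states at the ends of the transitions in `T`. -/
def transStates (T : List (S × A × S)) : List S := T.flatMap fun e => [e.1, e.2.2]

theorem mem_transStates_left {T : List (S × A × S)} {p q : S} {a : A} (h : (p, a, q) ∈ T) :
    p ∈ transStates T := List.mem_flatMap.2 ⟨_, h, by simp⟩

theorem mem_transStates_right {T : List (S × A × S)} {p q : S} {a : A} (h : (p, a, q) ∈ T) :
    q ∈ transStates T := List.mem_flatMap.2 ⟨_, h, by simp⟩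

theorem Runs.left_mem_transStates {T : List (S × A × S)} {p q : S} {w : List A} (hw : w ≠ [])
    (h : Runs T p w q) : p ∈ transStates T := by
  cases w with
  | nil => exact absurd rfl hw
  | cons a w =>
    obtain ⟨r, hr, -⟩ := h
    exact mem_transStates_left hr

theorem Runs.right_mem_transStates {T : List (S × A × S)} {p q : S} {w : List A} (hw : w ≠ [])
    (h : Runs T p w q) : q ∈ transStates T := by
  obtain ⟨w, a, rfl⟩ := List.eq_nil_or_concat w |>.resolve_left hw
  rw [List.concat_eq_append, runs_append] at h
  obtain ⟨r, -, r', h, rfl⟩ := h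
  exact mem_transStates_right h

end Runs

/-! ### Bernoulli measure of codes and of complete sets -/

theorem IsCode.subset {A : Type*} {X Y : Set (List A)} (hY : IsCode Y) (h : X ⊆ Y) : IsCode X :=
  fun xs ys hx hy => hY xs ys (fun x hx' => h (hx x hx')) fun y hy' => h (hy y hy')

section Measure

variable {A : Type*} [Fintype A]

theorem uniformMeasure_eq_tsum (X : Set (List A)) :
    uniformMeasure X = ∑' w : X, ((Fintype.card A : ℝ≥0∞)⁻¹) ^ w.1.length := by
  simp [uniformMeasure]

/-- The infinite sum is the supremum of its finite partial sums, and Kraft–McMillan bounds each of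
these. -/
theorem uniformMeasure_le_one_of_isCode [Nonempty A] {X : Set (List A)} (hX : IsCode X) :
    uniformMeasure X ≤ 1 := by
  classical
  rw [uniformMeasure_eq_tsum, ENNReal.tsum_eq_iSup_sum]
  refine iSup_le fun s => ?_
  have hs : InformationTheory.UniquelyDecodable ((s.map ⟨_, Subtype.val_injective⟩ :
      Finset (List A)) : Set (List A)) := fun L₁ L₂ h₁ h₂ =>
    hX L₁ L₂ (fun w hw => by
      obtain ⟨x, -, rfl⟩ := Finset.mem_map.1 (h₁ w hw); exact x.2)
      (fun w hw => by obtain ⟨x, -, rfl⟩ := Finset.mem_map.1 (h₂ w hw); exact x.2)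
  have hk := InformationTheory.kraft_mcmillan_inequality hs
  rw [Finset.sum_map] at hk
  have hc : (Fintype.card A : ℝ≥0∞)⁻¹ = ENNReal.ofReal (1 / Fintype.card A) := by
    rw [one_div, ENNReal.ofReal_inv_of_pos (by exact_mod_cast Fintype.card_pos),
      ENNReal.ofReal_natCast]
  calc ∑ w ∈ s, ((Fintype.card A : ℝ≥0∞)⁻¹) ^ w.1.length
      = ∑ w ∈ s, ENNReal.ofReal ((1 / Fintype.card A) ^ w.1.length) := by
        refine Finset.sum_congr rfl fun w _ => ?_
        rw [hc, ENNReal.ofReal_pow (by positivity)]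
    _ = ENNReal.ofReal (∑ w ∈ s, (1 / Fintype.card A) ^ w.1.length) :=
        (ENNReal.ofReal_sum_of_nonneg fun _ _ => by positivity).symm
    _ ≤ 1 := ENNReal.ofReal_le_one.2 hk

theorem uniformMeasure_insert {X : Set (List A)} {y : List A} (hy : y ∉ X) :
    uniformMeasure (insert y X) = (Fintype.card A : ℝ≥0∞)⁻¹ ^ y.length + uniformMeasure X := by
  rw [uniformMeasure_eq_tsum, uniformMeasure_eq_tsum, Set.insert_eq,
    ENNReal.summable.tsum_union_disjoint (f := fun w : List A =>
      ((Fintype.card A : ℝ≥0∞)⁻¹) ^ w.length) (by simpa using hy) ENNReal.summable]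
  simp

theorem IsCode.eq_of_uniformMeasure_eq_one [Nonempty A] {X Y : Set (List A)} (hY : IsCode Y)
    (hXY : X ⊆ Y) (h : uniformMeasure X = 1) : X = Y := by
  refine hXY.antisymm fun y hy => ?_
  by_contra hyX
  have h₁ := uniformMeasure_le_one_of_isCode (hY.subset (Set.insert_subset hy hXY))
  rw [uniformMeasure_insert hyX, h] at h₁
  have h₂ : (Fintype.card A : ℝ≥0∞)⁻¹ ^ y.length = 0 := by
    by_contra h0
    have := ENNReal.add_lt_add_right ENNReal.one_ne_top (pos_iff_ne_zero.2 h0)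
    rw [zero_add, add_comm] at this
    exact absurd (add_comm _ (1 : ℝ≥0∞) ▸ h₁) (by simpa [add_comm] using this)
  simp at h₂

/-- The words of each fixed length contribute exactly 1. -/
theorem uniformMeasure_univ [Nonempty A] : uniformMeasure (Set.univ : Set (List A)) = ⊤ := by
  rw [uniformMeasure_eq_tsum, tsum_univ (f := fun w : List A =>
      ((Fintype.card A : ℝ≥0∞)⁻¹) ^ w.length)]
  rw [← (Equiv.sigmaFiberEquiv (List.length : List A → ℕ)).tsum_eq, ENNReal.tsum_sigma']
  have : ∀ n : ℕ, ∑' w : {w : List A // w.length = n}, ((Fintype.card A : ℝ≥0∞)⁻¹) ^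
      ((Equiv.sigmaFiberEquiv (List.length : List A → ℕ)) ⟨n, w⟩).length = 1 := by
    intro n
    have h₁ : ∀ w : {w : List A // w.length = n},
        ((Equiv.sigmaFiberEquiv (List.length : List A → ℕ)) ⟨n, w⟩).length = n := fun w => w.2
    simp_rw [h₁]
    have : Fintype {w : List A // w.length = n} := inferInstanceAs (Fintype (List.Vector A n))
    rw [tsum_fintype, Finset.sum_const, Finset.card_univ, nsmul_eq_mul]
    have hc : Fintype.card {w : List A // w.length = n} = Fintype.card A ^ n := by
      rw [← card_vector n]
      exact Fintype.card_congr (Equiv.refl _)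
    rw [hc, Nat.cast_pow, ← mul_pow, ENNReal.mul_inv_cancel, one_pow]
    · simp
    · simp
  simp_rw [this]
  simp

theorem uniformMeasure_mono {X Y : Set (List A)} (h : X ⊆ Y) :
    uniformMeasure X ≤ uniformMeasure Y := by
  rw [uniformMeasure_eq_tsum, uniformMeasure_eq_tsum]
  exact ENNReal.tsum_mono_subtype (fun w : List A => ((Fintype.card A : ℝ≥0∞)⁻¹) ^ w.length) h

/-- Concatenation is multiplicative on weights and maps `X × Y` onto the product set. Words with
several factorizations are counted repeatedly on the right. -/
theorem uniformMeasure_image2_append_le (X Y : Set (List A)) :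
    uniformMeasure (Set.image2 (· ++ ·) X Y) ≤ uniformMeasure X * uniformMeasure Y := by
  simp only [uniformMeasure_eq_tsum]
  rw [← ENNReal.tsum_mul_right]
  simp_rw [← ENNReal.tsum_mul_left]
  rw [← ENNReal.tsum_prod]
  let g : X × Y → Set.image2 (· ++ ·) X Y :=
    fun p => ⟨p.1.1 ++ p.2.1, Set.mem_image2_of_mem p.1.2 p.2.2⟩
  have hg : Function.Surjective g := by
    rintro ⟨w, x, hx, y, hy, rfl⟩
    exact ⟨(⟨x, hx⟩, ⟨y, hy⟩), rfl⟩
  refine (ENNReal.tsum_le_tsum_comp_of_surjective hg _).trans (ENNReal.tsum_le_tsum fun p => ?_)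
  simp [g, pow_add]

theorem uniformMeasure_singleton_nil : uniformMeasure ({[]} : Set (List A)) = 1 := by
  simp [uniformMeasure_eq_tsum]

theorem uniformMeasure_iUnion_le {ι : Type*} (X : ι → Set (List A)) :
    uniformMeasure (⋃ i, X i) ≤ ∑' i, uniformMeasure (X i) := by
  simp only [uniformMeasure_eq_tsum]
  exact ENNReal.tsum_iUnion_le_tsum (fun w : List A =>
    ((Fintype.card A : ℝ≥0∞)⁻¹) ^ w.length) X

theorem uniformMeasure_union_le (X Y : Set (List A)) :
    uniformMeasure (X ∪ Y) ≤ uniformMeasure X + uniformMeasure Y := by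
  simp only [uniformMeasure_eq_tsum]
  exact ENNReal.tsum_union_le (fun w : List A => ((Fintype.card A : ℝ≥0∞)⁻¹) ^ w.length) X Y

theorem uniformMeasure_pow_le (X : Language A) (n : ℕ) :
    uniformMeasure (X ^ n : Language A) ≤ uniformMeasure X ^ n := by
  induction n with
  | zero =>
    rw [pow_zero, pow_zero]
    exact (uniformMeasure_singleton_nil (A := A)).le
  | succ n ih =>
    rw [pow_succ, pow_succ]
    exact (uniformMeasure_image2_append_le _ _).trans (by gcongr)

theorem uniformMeasure_kstar_lt_top {X : Language A} (h : uniformMeasure X < 1) :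
    uniformMeasure (X∗ : Language A) < ⊤ := by
  have hsub : (X∗ : Language A) ≤ ((⋃ n, (X ^ n : Language A) : Set (List A))) :=
    (Language.kstar_eq_iSup_pow X).le
  refine (((uniformMeasure_mono hsub).trans (uniformMeasure_iUnion_le _)).trans
    (ENNReal.tsum_le_tsum (uniformMeasure_pow_le X))).trans_lt ?_
  rw [ENNReal.tsum_geometric]
  simpa using h

/-- The map `w ↦ u w v` is injective and scales weights by a fixed nonzero factor. -/
theorem uniformMeasure_setOf_append_lt_top [Nonempty A] {X : Set (List A)}
    (h : uniformMeasure X < ⊤) (u v : List A) :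
    uniformMeasure {w | u ++ w ++ v ∈ X} < ⊤ := by
  set c : ℝ≥0∞ := (Fintype.card A : ℝ≥0∞)⁻¹ with hc
  have hc0 : c ≠ 0 := by simp [hc]
  have hct : c ≠ ⊤ := by simp [hc]
  have h₁ : c ^ (u.length + v.length) * uniformMeasure {w | u ++ w ++ v ∈ X} ≤
      uniformMeasure X := by
    simp only [uniformMeasure_eq_tsum, ← hc]
    rw [← ENNReal.tsum_mul_left]
    let g : {w | u ++ w ++ v ∈ X} → X := fun w => ⟨u ++ w.1 ++ v, w.2⟩
    have hg : Function.Injective g := fun w w' hw => by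
      simpa [g, Subtype.ext_iff] using hw
    refine le_trans (le_of_eq ?_) (ENNReal.tsum_comp_le_tsum_of_injective hg _)
    refine tsum_congr fun w => ?_
    simp only [g, List.length_append, pow_add]
    ring
  by_contra hcon
  rw [not_lt, top_le_iff] at hcon
  rw [hcon, ENNReal.mul_top (pow_ne_zero _ hc0)] at h₁
  exact absurd h₁ (not_le.2 h)

theorem one_le_uniformMeasure_of_isCompleteSet [Nonempty A] {X : Language A} (hX : X.IsRegular)
    (hc : IsCompleteSet X) : 1 ≤ uniformMeasure X := by
  by_contra! hlt
  obtain ⟨D, rfl⟩ := AutomatonCode.exists_behavior_eq hX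
  have hfin := uniformMeasure_kstar_lt_top hlt
  set T := starTrans D
  set V : Set ℕ := {p | p ∈ transStates T ∧ IsTrim T D.2.1 D.2.2 p} with hV
  have hVfin : V.Finite := (transStates T).finite_toSet.subset fun p hp => hp.1
  have hl : ∀ p : V, ∃ u, ∃ i ∈ D.2.1, Runs T i u p := fun ⟨p, _, ⟨i, hi, u, hu⟩, _⟩ =>
    ⟨u, i, hi, hu⟩
  have hr : ∀ p : V, ∃ v, ∃ t ∈ D.2.2, Runs T p v t := fun ⟨p, _, _, ⟨t, ht, v, hv⟩⟩ =>
    ⟨v, t, ht, hv⟩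
  choose u hu using hl
  choose v hv using hr
  have := hVfin.fintype
  -- One access word `u p` and one exit word `v p` per trim state suffice: a run from `p` to `q`
  -- over `w` extends to a successful run over `u p ++ w ++ v q`.
  have hcov : (Set.univ : Set (List A)) ⊆ {[]} ∪ ⋃ p : V × V,
      {w | u p.1 ++ w ++ v p.2 ∈ (D.behavior∗ : Language A)} := by
    intro w _
    by_cases hw : w = []
    · exact .inl hw
    obtain ⟨y, hy, hwy⟩ := hc w
    obtain ⟨p, q, hp, hq, hpq⟩ := exists_runs_starTrans_of_isInfix hw hy hwy
    obtain ⟨i, hi, hui⟩ := hu ⟨p, hpq.left_mem_transStates hw, hp⟩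
    obtain ⟨t, ht, hvt⟩ := hv ⟨q, hpq.right_mem_transStates hw, hq⟩
    refine .inr (Set.mem_iUnion.2 ⟨(⟨p, hpq.left_mem_transStates hw, hp⟩,
      ⟨q, hpq.right_mem_transStates hw, hq⟩), ?_⟩)
    exact mem_kstar_of_runs_starTrans hi ht
      (runs_append.2 ⟨q, runs_append.2 ⟨p, hui, hpq⟩, hvt⟩)
  have h₁ := uniformMeasure_mono hcov
  rw [uniformMeasure_univ] at h₁
  have h₂ := (h₁.trans (uniformMeasure_union_le _ _)).trans
    (add_le_add le_rfl (uniformMeasure_iUnion_le _))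
  rw [top_le_iff, tsum_fintype] at h₂
  refine absurd h₂ (ENNReal.add_lt_top.2 ⟨by simp [uniformMeasure_singleton_nil],
    ENNReal.sum_lt_top.2 fun p _ => ?_⟩).ne
  exact uniformMeasure_setOf_append_lt_top hfin (u p.1) (v p.2)

end Measure

/-! ### Adding an unbordered word to a code -/

section Embedding

variable {A : Type*}

/-- No nonempty proper prefix of `y` is a suffix of `y`. -/
def IsUnbordered (y : List A) : Prop :=
  ∀ r s t : List A, r ++ s = y → t ++ r = y → r = [] ∨ r = y

/-- A border makes `y` agree with its shift by `|t|`. A shift beyond `|w| + 1` matches the first `a`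
with a final `b`; a shorter one moves the second `a` onto a `b`. The `|w| + 1` final letters keep
that position inside `y`. -/
theorem isUnbordered_append_replicate {a b : A} (hab : a ≠ b) (w : List A) :
    IsUnbordered (a :: w ++ (a :: List.replicate (w.length + 1) b)) := by
  intro r s t hs ht
  by_contra! hr
  obtain ⟨hr0, hr1⟩ := hr
  set y := a :: w ++ (a :: List.replicate (w.length + 1) b) with hy
  have hy0 : y[0]? = some a := by simp [hy]
  have hyl : y.length = 2 * w.length + 3 := by simp [hy]; omega
  have hya : y[w.length + 1]? = some a := by simp [hy]
  have hyb : ∀ k, w.length + 1 < k → k < y.length → y[k]? = some b := by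
    intro k h1 h2
    rw [hy, List.getElem?_append_right (by simp; omega)]
    obtain ⟨j, rfl⟩ := Nat.exists_eq_add_of_lt h1
    have e : w.length + 1 + j + 1 - (a :: w).length = j + 1 := by simp; omega
    rw [e, List.getElem?_cons_succ, List.getElem?_replicate, if_pos (by omega)]
  have hlen : r.length + s.length = y.length := by rw [← hs, List.length_append]
  have hlen' : t.length + r.length = y.length := by rw [← ht, List.length_append]
  have hrpos : 0 < r.length := List.length_pos_iff.2 hr0
  have hshift : ∀ k, k < r.length → y[k]? = y[t.length + k]? := by
    intro k hk
    conv_lhs => rw [← hs, List.getElem?_append_left hk]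
    conv_rhs => rw [← ht, List.getElem?_append_right (by omega), Nat.add_sub_cancel_left]
  have ht0 : 0 < t.length := by
    by_contra h0
    have : t = [] := List.length_eq_zero_iff.1 (by omega)
    exact hr1 (by simpa [this] using ht)
  have h0 := hshift 0 hrpos
  by_cases htl : w.length + 1 < t.length
  · rw [hy0, hyb _ (by omega) (by omega)] at h0
    exact hab (Option.some.inj h0)
  · have h1 := hshift (w.length + 1) (by omega)
    rw [hya, hyb _ (by omega) (by omega)] at h1
    exact hab (Option.some.inj h1)

/-- Either `y` is not used, or the factorization is cut at a first use of `y`. -/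
theorem exists_eq_append_cons_or_forall_mem {X : Set (List A)} {y : List A}
    {L : List (List A)} (hL : ∀ x ∈ L, x ∈ insert y X) :
    (∀ x ∈ L, x ∈ X) ∨ ∃ P R, L = P ++ y :: R ∧ (∀ x ∈ P, x ∈ X) ∧ ∀ x ∈ R, x ∈ insert y X := by
  induction L with
  | nil => exact .inl (by simp)
  | cons x L ih =>
    simp only [List.forall_mem_cons] at hL
    rcases hL.1 with rfl | hx
    · exact .inr ⟨[], L, rfl, by simp, hL.2⟩
    rcases ih hL.2 with h | ⟨P, R, rfl, hP, hR⟩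
    · exact .inl (by simpa using ⟨hx, h⟩)
    · exact .inr ⟨x :: P, R, rfl, by simpa using ⟨hx, hP⟩, hR⟩

theorem append_eq_append_of_isUnbordered {y p q r s : List A} (hy : IsUnbordered y)
    (hp : ¬ y <:+: p) (hq : ¬ y <:+: q) (h : p ++ (y ++ r) = q ++ (y ++ s)) :
    p = q ∧ r = s := by
  have key : ∀ {p q r s : List A}, ¬ y <:+: q → p ++ (y ++ r) = q ++ (y ++ s) →
      p.length < q.length → False := by
    intro p q r s hq h hlt
    rcases List.append_eq_append_iff.1 h with ⟨c, rfl, h₁⟩ | ⟨c, rfl, -⟩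
    · rcases List.append_eq_append_iff.1 h₁ with ⟨d, rfl, -⟩ | ⟨d, hd, h₂⟩
      · exact hq ⟨p, d, by simp⟩
      · have hdl := congrArg List.length hd
        rw [List.length_append] at hdl hlt
        rcases List.append_eq_append_iff.1 h₂ with ⟨e, he, -⟩ | ⟨e, he, -⟩
        · have hel := congrArg List.length he
          rw [List.length_append] at hel
          omega
        -- The overlap `d` of the two occurrences is both a prefix and a suffix of `y`.
        · rcases hy d e c he.symm hd.symm with rfl | h₃
          · exact hq ⟨p, [], by simp [hd]⟩
          · rw [h₃] at hdl
            omega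
    · simp at hlt
  rcases lt_trichotomy p.length q.length with hlt | heq | hlt
  · exact (key hq h hlt).elim
  · obtain ⟨rfl, h⟩ := List.append_inj h heq
    exact ⟨rfl, List.append_cancel_left (List.append_cancel_left h)⟩
  · exact (key hp h.symm hlt).elim

/-- Two factorizations of one word must both use `y` or both avoid it, as `y` is no factor of `X∗`.
Unborderedness makes their first uses of `y` coincide: the parts before agree since `X` is a code,
and those after by induction on the number of factors. -/
theorem IsCode.insert_of_isUnbordered {X : Language A} (hX : IsCode X) {y : List A}
    (hu : IsUnbordered y) (hy : ∀ z ∈ X∗, ¬ y <:+: z) :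
    IsCode (insert y (X : Set (List A))) := by
  have hstar : ∀ L : List (List A), (∀ x ∈ L, x ∈ X) → ¬ y <:+: L.flatten := fun L hL =>
    hy _ (Language.join_mem_kstar hL)
  intro xs
  induction hn : xs.length using Nat.strong_induction_on generalizing xs with
  | _ n ih =>
  intro ys hxs hys h
  rcases exists_eq_append_cons_or_forall_mem hxs with hx | ⟨P, R, rfl, hP, hR⟩ <;>
    rcases exists_eq_append_cons_or_forall_mem hys with hy' | ⟨P', R', rfl, hP', hR'⟩
  · exact hX xs ys hx hy' h
  · refine (hstar xs hx ⟨P'.flatten, R'.flatten, ?_⟩).elim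
    rw [h]; simp
  · refine (hstar ys hy' ⟨P.flatten, R.flatten, ?_⟩).elim
    rw [← h]; simp
  · rw [List.flatten_append, List.flatten_append, List.flatten_cons, List.flatten_cons] at h
    obtain ⟨h₁, h₂⟩ := append_eq_append_of_isUnbordered hu (hstar P hP) (hstar P' hP') h
    rw [hX P P' hP hP' h₁, ih R.length (by simp at hn; omega) R rfl R' hR hR' h₂]

theorem exists_isCode_insert [Nontrivial A] {X : Language A} (hX : IsCode X) {w v : List A}
    (hw : ∀ z ∈ X∗, ¬ w <:+: z) (hwv : w <:+: v) :
    ∃ y, v <:+: y ∧ IsCode (insert y (X : Set (List A))) := by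
  obtain ⟨a, b, hab⟩ := exists_pair_ne A
  refine ⟨_, ?_, hX.insert_of_isUnbordered (isUnbordered_append_replicate hab v) fun z hz h => ?_⟩
  · exact ⟨[a], a :: List.replicate (v.length + 1) b, by simp⟩
  · refine hw z hz (hwv.trans (List.IsInfix.trans ?_ h))
    exact ⟨[a], a :: List.replicate (v.length + 1) b, by simp⟩

end Embedding

/-! ### Independent codes: existence of maximal ones and their completeness -/

section Independent

variable {A : Type*}

theorem antiReflRestr_reflClosure (τ : SetRel (List A) (List A)) :
    antiReflRestr (reflClosure τ) = antiReflRestr τ := by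
  simp [antiReflRestr, reflClosure]

theorem isIndependent_antiReflRestr_graph_iff {θ : List A → List A} {X : Set (List A)} :
    IsIndependent (antiReflRestr (Function.graph θ)) X ↔
      ∀ w ∈ X, θ w ∈ X → θ w = w := by
  rw [IsIndependent, Set.eq_empty_iff_forall_notMem]
  constructor
  · intro h w hw hθ
    by_contra hne
    exact h (θ w) ⟨⟨w, hw, rfl, fun e => hne (Eq.symm e)⟩, hθ⟩
  · rintro h w' ⟨⟨w, hw, he, hne⟩, hw'⟩
    have he : θ w = w' := he
    subst he
    exact hne (h w hw hw').symm

/-- Zorn's lemma applies because both properties are finitary: a violation involves finitely many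
words, which already lie in one member of the chain. -/
theorem exists_isMaximalIndependentCode (τ : SetRel (List A) (List A)) {X : Set (List A)}
    (hX : IsCode X) (hi : IsIndependent τ X) :
    ∃ Y, X ⊆ Y ∧ IsMaximalIndependentCode τ Y := by
  have hind : ∀ Y : Set (List A), IsIndependent τ Y ↔ ∀ u ∈ Y, ∀ v ∈ Y, (u, v) ∉ τ := by
    intro Y
    rw [IsIndependent, Set.eq_empty_iff_forall_notMem]
    exact ⟨fun h u hu v hv huv => h v ⟨⟨u, hu, huv⟩, hv⟩,
      fun h v ⟨⟨u, hu, huv⟩, hv⟩ => h u hu v hv huv⟩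
  refine zorn_subset_nonempty {Y : Set (List A) | IsCode Y ∧ IsIndependent τ Y} ?_ X ⟨hX, hi⟩
  intro c hc hchain hne
  have hdir : DirectedOn (· ⊆ ·) c := hchain.directedOn
  refine ⟨⋃₀ c, ⟨?_, ?_⟩, fun s hs => Set.subset_sUnion_of_mem hs⟩
  · intro xs ys hx hy h
    have hfin : {x | x ∈ xs ++ ys}.Finite := List.finite_toSet _
    obtain ⟨Y, hY, hsub⟩ := hdir.exists_mem_subset_of_finite_of_subset_sUnion hne hfin
      (fun x hx' => (List.mem_append.1 hx').elim (hx x) (hy x))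
    exact (hc hY).1 xs ys (fun x hx' => hsub (List.mem_append_left _ hx'))
      (fun x hx' => hsub (List.mem_append_right _ hx')) h
  · rw [hind]
    rintro u ⟨Y, hY, hu⟩ v ⟨Z, hZ, hv⟩
    obtain ⟨W, hW, hYW, hZW⟩ := hdir Y hY Z hZ
    exact (hind W).1 (hc hW).2 u (hYW hu) v (hZW hv)

/-- An anti-automorphism exchanges the left and right contexts of a factor. -/
theorem isInfix_map_iff {θ : List A → List A} (hθ : IsAutomorphism θ ∨ IsAntiAutomorphism θ)
    {u v : List A} : θ u <:+: θ v ↔ u <:+: v := by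
  have hb := hθ.elim (·.1) (·.1)
  constructor
  · rintro ⟨s, t, h⟩
    obtain ⟨s, rfl⟩ := hb.2 s
    obtain ⟨t, rfl⟩ := hb.2 t
    rcases hθ with hθ | hθ
    · exact ⟨s, t, hb.1 (by rw [hθ.2, hθ.2, h])⟩
    · exact ⟨t, s, hb.1 (by rw [hθ.2, hθ.2, ← h, List.append_assoc])⟩
  · rintro ⟨s, t, rfl⟩
    rcases hθ with hθ | hθ
    · exact ⟨θ s, θ t, by simp [hθ.2]⟩
    · exact ⟨θ t, θ s, by simp [hθ.2]⟩

theorem isCompleteSet_of_isMaximalIndependentCode [Nontrivial A] {θ : List A → List A}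
    (hθ : IsAutomorphism θ ∨ IsAntiAutomorphism θ) {X : Language A}
    (hX : IsMaximalIndependentCode (antiReflRestr (Function.graph θ)) X) : IsCompleteSet X := by
  by_contra hcon
  simp only [IsCompleteSet, not_forall, not_exists, not_and] at hcon
  obtain ⟨w, hw⟩ := hcon
  obtain ⟨w', rfl⟩ : ∃ w', θ w' = w := (hθ.elim (·.1) (·.1)).2 w
  -- The factor `θ w'` is the incompletable word and keeps `y` out of `X`. The factor `w'` puts `θ
  -- w'` into `θ y`, and `θ (θ w')` puts `θ w'` into any `x` with `θ x = y`.
  obtain ⟨y, hvy, hcode⟩ := exists_isCode_insert hX.prop.1 hw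
    (v := θ w' ++ (θ (θ w') ++ w')) ⟨[], θ (θ w') ++ w', by simp⟩
  have hwy : θ w' <:+: y := List.IsInfix.trans ⟨[], θ (θ w') ++ w', by simp⟩ hvy
  have hw'y : w' <:+: y := List.IsInfix.trans ⟨θ w' ++ θ (θ w'), [], by simp⟩ hvy
  have hθy : θ (θ w') <:+: y := List.IsInfix.trans ⟨θ w', w', by simp⟩ hvy
  have hX' : ∀ x ∈ X, ¬ θ w' <:+: x := fun x hx => hw x (le_kstar (a := X) hx)
  have hyX : y ∉ X := fun h => hX' y h hwy
  refine hyX (hX.le_of_ge (y := insert y (X : Set (List A))) ⟨hcode, ?_⟩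
    (Set.subset_insert _ _) (Set.mem_insert _ _))
  have hi := isIndependent_antiReflRestr_graph_iff.1 hX.prop.2
  refine isIndependent_antiReflRestr_graph_iff.2 ?_
  rintro x (rfl | hx) (hx' | hx')
  · exact hx'
  · exact (hX' _ hx' ((isInfix_map_iff hθ).2 hw'y)).elim
  · exact (hX' _ hx ((isInfix_map_iff hθ).1 (hx'.symm ▸ hθy))).elim
  · exact hi x hx hx'

end Independent

/-! ### Primitive recursive reachability in finite graphs -/

section Reachability

variable {α β γ : Type*} [Primcodable α] [Primcodable β] [Primcodable γ]

theorem PrimrecPred.exists_mem {f : α → List β} {R : α → β → Prop} (hf : Primrec f)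
    (hR : PrimrecPred fun p : α × β => R p.1 p.2) : PrimrecPred fun x => ∃ b ∈ f x, R x b := by
  have h : PrimrecRel fun b x => R x b := hR.comp (Primrec.snd.pair Primrec.fst)
  exact h.exists_mem_list.comp hf Primrec.id

theorem PrimrecPred.mem {f : α → List β} {g : α → β} (hf : Primrec f) (hg : Primrec g) :
    PrimrecPred fun x => g x ∈ f x :=
  (PrimrecPred.exists_mem (R := fun x b => b = g x) hf
    (Primrec.eq.comp Primrec.snd (hg.comp Primrec.fst))).of_eq fun x => by simp

theorem Primrec.list_filter_rel {f : α → List β} {R : α → β → Prop}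
    [∀ x, DecidablePred (R x)] (hf : Primrec f)
    (hR : PrimrecPred fun p : α × β => R p.1 p.2) :
    Primrec fun x => (f x).filter fun b => decide (R x b) := by
  have h : PrimrecRel fun b x => R x b := hR.comp (Primrec.snd.pair Primrec.fst)
  have : DecidableRel fun b x => R x b := fun b x => inferInstanceAs (Decidable (R x b))
  refine (h.listFilter.comp hf Primrec.id).of_eq fun x => ?_
  congr!

theorem Primrec.list_product {f : α → List β} {g : α → List γ} (hf : Primrec f)
    (hg : Primrec g) : Primrec fun x => (f x).product (g x) :=
  (Primrec.list_flatMap (g := fun x b => (g x).map fun c => (b, c)) hf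
    (Primrec.list_map (hg.comp Primrec.fst)
      (Primrec.pair (Primrec.snd.comp Primrec.fst) Primrec.snd))).of_eq fun _ => rfl

theorem Primrec.list_sublists' : Primrec (List.sublists' : List α → List (List α)) := by
  have h : Primrec fun l : List α => l.foldr (fun a L => L ++ L.map (List.cons a)) [[]] :=
    Primrec.list_foldr (h := fun _ (p : α × List (List α)) => p.2 ++ p.2.map (List.cons p.1)) Primrec.id
      (Primrec.const _)
      (Primrec.list_append.comp (Primrec.snd.comp Primrec.snd)
        (Primrec.list_map (Primrec.snd.comp Primrec.snd)
          (Primrec.list_cons.comp (Primrec.fst.comp (Primrec.snd.comp Primrec.fst))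
            Primrec.snd).to₂)).to₂
  refine h.of_eq fun l => ?_
  induction l with
  | nil => rfl
  | cons a l ih => rw [List.foldr_cons, ih, List.sublists'_cons]

open Classical in
/-- The pairs of vertices joined by a nonempty path, in the graph with the given edges. -/
noncomputable def transPairs {α : Type*} (E : List (α × α)) : List (α × α) :=
  E.foldr (fun e P => P ++
    (e.1 :: (P.filter fun p => p.2 = e.1).map Prod.fst).product
      (e.2 :: (P.filter fun p => p.1 = e.2).map Prod.snd)) []

/-- When an edge `(a, b)` is added, a path that uses it repeatedly can be shortened to use it once,
between an old path to `a` and an old path from `b`, either possibly trivial. -/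
theorem mem_transPairs {α : Type*} {E : List (α × α)} {s t : α} :
    (s, t) ∈ transPairs E ↔ Relation.TransGen (fun x y => (x, y) ∈ E) s t := by
  classical
  induction E generalizing s t with
  | nil =>
    refine ⟨fun h => absurd h List.not_mem_nil, fun h => ?_⟩
    obtain ⟨_, h, -⟩ := Relation.TransGen.head'_iff.1 h
    exact absurd h List.not_mem_nil
  | cons e E ih =>
    obtain ⟨a, b⟩ := e
    have h₁ : (s, t) ∈ transPairs ((a, b) :: E) ↔ (s, t) ∈ transPairs E ∨
        (s = a ∨ (s, a) ∈ transPairs E) ∧ (t = b ∨ (b, t) ∈ transPairs E) := by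
      rw [transPairs, List.foldr_cons, ← transPairs, List.mem_append, List.pair_mem_product]
      simp
    simp only [h₁, ih]
    have hmono : ∀ {x y : α}, Relation.TransGen (fun x y => (x, y) ∈ E) x y →
        Relation.TransGen (fun x y => (x, y) ∈ (a, b) :: E) x y := fun h =>
      Relation.TransGen.mono (fun _ _ => List.mem_cons_of_mem _) _ _ h
    have hab : Relation.TransGen (fun x y => (x, y) ∈ (a, b) :: E) a b :=
      .single List.mem_cons_self
    constructor
    · rintro (h | ⟨rfl | h, rfl | h'⟩)
      · exact hmono h
      · exact hab
      · exact hab.trans (hmono h')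
      · exact (hmono h).trans hab
      · exact ((hmono h).trans hab).trans (hmono h')
    · intro h
      clear h₁
      induction h with
      | single h =>
        rcases List.mem_cons.1 h with h | h
        · cases h
          exact .inr ⟨.inl rfl, .inl rfl⟩
        · exact .inl (.single h)
      | tail _ h ih' =>
        rcases List.mem_cons.1 h with h₁ | h₁
        · cases h₁
          rcases ih' with h' | ⟨h', -⟩
          · exact .inr ⟨.inr h', .inl rfl⟩
          · exact .inr ⟨h', .inl rfl⟩
        · rcases ih' with h' | ⟨h', rfl | h''⟩
          · exact .inl (h'.tail h₁)
          · exact .inr ⟨h', .inr (.single h₁)⟩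
          · exact .inr ⟨h', .inr (h''.tail h₁)⟩

theorem primrec_transPairs : Primrec (transPairs : List (α × α) → List (α × α)) := by
  classical
  refine Primrec.list_foldr (h := fun _ (q : (α × α) × List (α × α)) => q.2 ++
    (q.1.1 :: (q.2.filter fun p => p.2 = q.1.1).map Prod.fst).product
      (q.1.2 :: (q.2.filter fun p => p.1 = q.1.2).map Prod.snd)) Primrec.id (Primrec.const _) ?_
  have hq : Primrec fun x : List (α × α) × (α × α) × List (α × α) => x.2.1 :=
    Primrec.fst.comp Primrec.snd
  have hP : Primrec fun x : List (α × α) × (α × α) × List (α × α) => x.2.2 :=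
    Primrec.snd.comp Primrec.snd
  refine Primrec.list_append.comp hP (Primrec.list_product ?_ ?_)
  · refine Primrec.list_cons.comp (Primrec.fst.comp hq)
      (Primrec.list_map (Primrec.list_filter_rel hP ?_) (Primrec.fst.comp Primrec.snd))
    exact Primrec.eq.comp (Primrec.snd.comp Primrec.snd)
      (Primrec.fst.comp (hq.comp Primrec.fst))
  · refine Primrec.list_cons.comp (Primrec.snd.comp hq)
      (Primrec.list_map (Primrec.list_filter_rel hP ?_) (Primrec.snd.comp Primrec.snd))
    exact Primrec.eq.comp (Primrec.fst.comp Primrec.snd)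
      (Primrec.snd.comp (hq.comp Primrec.fst))

theorem PrimrecPred.reflTransGen {E : α → List (β × β)} {s t : α → β} (hE : Primrec E)
    (hs : Primrec s) (ht : Primrec t) :
    PrimrecPred fun x => Relation.ReflTransGen (fun a b => (a, b) ∈ E x) (s x) (t x) := by
  refine ((Primrec.eq.comp ht hs).or
    (PrimrecPred.mem (primrec_transPairs.comp hE) (hs.pair ht))).of_eq fun x => ?_
  rw [Relation.reflTransGen_iff_eq_or_transGen, mem_transPairs]

end Reachability

/-! ### Deciding the existence of runs -/

section Trim

variable {A S : Type*}

theorem reflTransGen_iff_exists_runs {T : List (S × A × S)} {p q : S} :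
    Relation.ReflTransGen (fun x y => (x, y) ∈ T.map fun e => (e.1, e.2.2)) p q ↔
      ∃ w, Runs T p w q := by
  constructor
  · intro h
    induction h with
    | refl => exact ⟨[], rfl⟩
    | @tail r s _ h ih =>
      obtain ⟨w, hw⟩ := ih
      obtain ⟨⟨p', a, q'⟩, he, h⟩ := List.mem_map.1 h
      cases h
      exact ⟨w ++ [a], runs_append.2 ⟨_, hw, _, he, rfl⟩⟩
  · rintro ⟨w, hw⟩
    induction w generalizing p with
    | nil => exact hw ▸ .refl
    | cons a w ih =>
      obtain ⟨r, he, hr⟩ := hw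
      exact .head (List.mem_map.2 ⟨_, he, rfl⟩) (ih hr)

variable {α : Type*} [Primcodable α] [Primcodable A] [Primcodable S]

theorem PrimrecPred.exists_runs {T : α → List (S × A × S)} {p q : α → S} (hT : Primrec T)
    (hp : Primrec p) (hq : Primrec q) : PrimrecPred fun x => ∃ w, Runs (T x) (p x) w (q x) := by
  refine (PrimrecPred.reflTransGen (E := fun x => (T x).map fun e => (e.1, e.2.2))
    (Primrec.list_map hT ?_) hp hq).of_eq fun x => reflTransGen_iff_exists_runs
  exact Primrec.pair (Primrec.fst.comp Primrec.snd)
    (Primrec.snd.comp (Primrec.snd.comp Primrec.snd))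

theorem PrimrecPred.exists_runs_from {T : α → List (S × A × S)} {I : α → List S} {p : α → S}
    (hT : Primrec T) (hI : Primrec I) (hp : Primrec p) :
    PrimrecPred fun x => ∃ i ∈ I x, ∃ u, Runs (T x) i u (p x) :=
  PrimrecPred.exists_mem hI
    (PrimrecPred.exists_runs (hT.comp Primrec.fst) Primrec.snd (hp.comp Primrec.fst))

theorem PrimrecPred.exists_runs_to {T : α → List (S × A × S)} {F : α → List S} {p : α → S}
    (hT : Primrec T) (hF : Primrec F) (hp : Primrec p) :
    PrimrecPred fun x => ∃ t ∈ F x, ∃ v, Runs (T x) (p x) v t :=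
  PrimrecPred.exists_mem hF
    (PrimrecPred.exists_runs (hT.comp Primrec.fst) (hp.comp Primrec.fst) Primrec.snd)

theorem PrimrecPred.isTrim {T : α → List (S × A × S)} {I F : α → List S} {p : α → S}
    (hT : Primrec T) (hI : Primrec I) (hF : Primrec F) (hp : Primrec p) :
    PrimrecPred fun x => IsTrim (T x) (I x) (F x) (p x) :=
  (PrimrecPred.exists_runs_from hT hI hp).and (PrimrecPred.exists_runs_to hT hF hp)

theorem primrec_starTrans : Primrec (starTrans : AutomatonCode A → List (ℕ × A × ℕ)) := by
  refine Primrec.list_append.comp Primrec.fst (Primrec.list_flatMap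
    (g := fun (D : AutomatonCode A) (e : ℕ × A × ℕ) => D.2.1.map fun i => (e.1, e.2.1, i))
    (Primrec.list_filter_rel
      (R := fun (D : AutomatonCode A) (e : ℕ × A × ℕ) => e.2.2 ∈ D.2.2) Primrec.fst ?_)
    (Primrec.list_map (f := fun x : AutomatonCode A × ℕ × A × ℕ => x.1.2.1)
      (g := fun x i => (x.2.1, x.2.2.1, i)) ?_ ?_))
  · exact PrimrecPred.mem (Primrec.snd.comp (Primrec.snd.comp Primrec.fst))
      (Primrec.snd.comp (Primrec.snd.comp Primrec.snd))
  · exact Primrec.fst.comp (Primrec.snd.comp Primrec.fst)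
  · exact Primrec.pair (Primrec.fst.comp (Primrec.snd.comp Primrec.fst))
      (Primrec.pair (Primrec.fst.comp (Primrec.snd.comp (Primrec.snd.comp Primrec.fst)))
        Primrec.snd)

theorem primrec_transStates :
    Primrec (transStates : List (S × A × S) → List S) :=
  Primrec.list_flatMap Primrec.id (Primrec.list_cons.comp (Primrec.fst.comp Primrec.snd)
    (Primrec.list_cons.comp (Primrec.snd.comp (Primrec.snd.comp Primrec.snd))
      (Primrec.const [])))

end Trim

/-! ### Deciding completeness by the subset construction -/

section Completeness

variable {A : Type*}

open Classical in
/-- The transitions between the states that lie on a run from an initial to a terminal state, in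
the automaton for the submonoid generated by a described set. -/
noncomputable def trimTrans (D : AutomatonCode A) : List (ℕ × A × ℕ) :=
  (starTrans D).filter fun e => IsTrim (starTrans D) D.2.1 D.2.2 e.1 ∧
    IsTrim (starTrans D) D.2.1 D.2.2 e.2.2

theorem mem_trimTrans {D : AutomatonCode A} {p q : ℕ} {a : A} :
    (p, a, q) ∈ trimTrans D ↔ (p, a, q) ∈ starTrans D ∧
      IsTrim (starTrans D) D.2.1 D.2.2 p ∧ IsTrim (starTrans D) D.2.1 D.2.2 q := by
  simp [trimTrans]

/-- Every state on a run between two trim states is itself trim. -/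
theorem runs_trimTrans {D : AutomatonCode A} {p q : ℕ} {w : List A}
    (hp : IsTrim (starTrans D) D.2.1 D.2.2 p) (hq : IsTrim (starTrans D) D.2.1 D.2.2 q)
    (h : Runs (starTrans D) p w q) : Runs (trimTrans D) p w q := by
  induction w generalizing p with
  | nil => exact h
  | cons a w ih =>
    obtain ⟨r, he, hr⟩ := h
    have htr : IsTrim (starTrans D) D.2.1 D.2.2 r := by
      obtain ⟨⟨i, hi, u, hu⟩, -⟩ := hp
      obtain ⟨-, t, ht, v, hv⟩ := hq
      exact ⟨⟨i, hi, u ++ [a], runs_append.2 ⟨p, hu, r, he, rfl⟩⟩,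
        t, ht, w ++ v, runs_append.2 ⟨q, hr, hv⟩⟩
    exact ⟨r, mem_trimTrans.2 ⟨he, hp, htr⟩, ih htr hr⟩

theorem isTrim_of_mem_transStates {D : AutomatonCode A} {p : ℕ}
    (hp : p ∈ transStates (trimTrans D)) : IsTrim (starTrans D) D.2.1 D.2.2 p := by
  obtain ⟨⟨r, a, s⟩, he, hp⟩ := List.mem_flatMap.1 hp
  obtain ⟨-, h₁, h₂⟩ := mem_trimTrans.1 he
  rcases List.mem_cons.1 hp with rfl | hp
  · exact h₁
  · rwa [List.mem_singleton.1 hp]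

/-- Factors of `X∗` are the labels of runs between trim states, so completeness means that no word
empties the set of all states of the trimmed automaton. -/
theorem isCompleteSet_behavior_iff [Nonempty A] {D : AutomatonCode A} :
    IsCompleteSet D.behavior ↔
      ∀ w, ∃ q, ∃ p ∈ transStates (trimTrans D), Runs (trimTrans D) p w q := by
  have hsub : trimTrans D ⊆ starTrans D := List.filter_subset_self _
  constructor
  · intro h w
    obtain ⟨a⟩ := ‹Nonempty A›
    -- The extra letter makes the run nonempty, so its origin is an end of a transition even for `w
    -- = []`.
    obtain ⟨y, hy, hwy⟩ := h (w ++ [a])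
    obtain ⟨p, q, hp, hq, hr⟩ := exists_runs_starTrans_of_isInfix (by simp) hy hwy
    have hr' := runs_trimTrans hp hq hr
    obtain ⟨r, hw, -⟩ := runs_append.1 hr'
    exact ⟨r, p, hr'.left_mem_transStates (by simp), hw⟩
  · intro h w
    by_cases hw : w = []
    · exact ⟨[], Language.nil_mem_kstar _, by simp [hw]⟩
    obtain ⟨q, p, hp, hr⟩ := h w
    exact exists_isInfix_of_runs_starTrans (isTrim_of_mem_transStates hp)
      (isTrim_of_mem_transStates (hr.right_mem_transStates hw)) (hr.mono hsub)

section Subset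

variable {S : Type*}

open Classical in
/-- The step of the subset construction. -/
noncomputable def subsetStep (T : List (S × A × S)) (P : List S) (a : A) : List S :=
  (transStates T).filter fun q => ∃ p ∈ P, (p, a, q) ∈ T

theorem mem_subsetStep {T : List (S × A × S)} {P : List S} {a : A} {q : S} :
    q ∈ subsetStep T P a ↔ ∃ p ∈ P, (p, a, q) ∈ T := by
  simp only [subsetStep, List.mem_filter, decide_eq_true_eq, and_iff_right_iff_imp]
  rintro ⟨p, -, h⟩
  exact mem_transStates_right h

theorem mem_foldl_subsetStep {T : List (S × A × S)} {P : List S} {w : List A} {q : S} :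
    q ∈ w.foldl (subsetStep T) P ↔ ∃ p ∈ P, Runs T p w q := by
  induction w generalizing P with
  | nil => simp
  | cons a w ih =>
    rw [List.foldl_cons, ih]
    simp only [mem_subsetStep, runs_cons]
    exact ⟨fun ⟨r, ⟨p, hp, h⟩, hr⟩ => ⟨p, hp, r, h, hr⟩,
      fun ⟨p, hp, r, h, hr⟩ => ⟨r, ⟨p, hp, h⟩, hr⟩⟩

/-- The edges of the subset construction, over the letters in `l`. -/
noncomputable def subsetEdges (l : List A) (T : List (S × A × S)) : List (List S × List S) :=
  (transStates T).sublists'.flatMap fun P => l.map fun a => (P, subsetStep T P a)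

theorem mem_subsetEdges {l : List A} {T : List (S × A × S)} {P Q : List S} :
    (P, Q) ∈ subsetEdges l T ↔ P.Sublist (transStates T) ∧ ∃ a ∈ l, Q = subsetStep T P a := by
  simp only [subsetEdges, List.mem_flatMap, List.mem_sublists', List.mem_map, Prod.mk.injEq]
  constructor
  · rintro ⟨P, hP, a, ha, rfl, rfl⟩
    exact ⟨hP, a, ha, rfl⟩
  · rintro ⟨hP, a, ha, rfl⟩
    exact ⟨P, hP, a, ha, rfl, rfl⟩

/-- Every list reached is the full state list or a filter of it, hence one of the finitely many
sublists used as vertices. -/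
theorem reflTransGen_subsetEdges_iff {l : List A} (hl : ∀ a, a ∈ l) {T : List (S × A × S)}
    {Q : List S} :
    Relation.ReflTransGen (fun x y => (x, y) ∈ subsetEdges l T) (transStates T) Q ↔
      ∃ w : List A, w.foldl (subsetStep T) (transStates T) = Q := by
  constructor
  · intro h
    induction h with
    | refl => exact ⟨[], rfl⟩
    | tail _ h ih =>
      obtain ⟨w, rfl⟩ := ih
      obtain ⟨-, a, -, rfl⟩ := mem_subsetEdges.1 h
      exact ⟨w ++ [a], by simp⟩
  · rintro ⟨w, rfl⟩
    induction w using List.reverseRecOn with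
    | nil => exact .refl
    | append_singleton w a ih =>
      refine ih.tail (mem_subsetEdges.2 ⟨?_, a, hl a, by simp⟩)
      rcases List.eq_nil_or_concat w with rfl | ⟨w, b, rfl⟩
      · exact .refl _
      · simp only [List.concat_eq_append, List.foldl_append, List.foldl_cons, List.foldl_nil]
        exact List.filter_sublist

end Subset

variable [Primcodable A]

theorem primrec_trimTrans : Primrec (trimTrans : AutomatonCode A → List (ℕ × A × ℕ)) := by
  classical
  have hT : Primrec fun x : AutomatonCode A × ℕ × A × ℕ => starTrans x.1 :=
    primrec_starTrans.comp Primrec.fst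
  have hI : Primrec fun x : AutomatonCode A × ℕ × A × ℕ => x.1.2.1 :=
    Primrec.fst.comp (Primrec.snd.comp Primrec.fst)
  have hF : Primrec fun x : AutomatonCode A × ℕ × A × ℕ => x.1.2.2 :=
    Primrec.snd.comp (Primrec.snd.comp Primrec.fst)
  refine (Primrec.list_filter_rel (R := fun D e => IsTrim (starTrans D) D.2.1 D.2.2 e.1 ∧
    IsTrim (starTrans D) D.2.1 D.2.2 e.2.2) primrec_starTrans
    ((PrimrecPred.isTrim hT hI hF (Primrec.fst.comp Primrec.snd)).and
      (PrimrecPred.isTrim hT hI hF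
        (Primrec.snd.comp (Primrec.snd.comp Primrec.snd))))).of_eq fun D => ?_
  simp only [trimTrans]

theorem primrec_subsetEdges {S : Type*} [Primcodable S] (l : List A) :
    Primrec (subsetEdges l : List (S × A × S) → List (List S × List S)) := by
  classical
  refine Primrec.list_flatMap (g := fun T P => l.map fun a => (P, subsetStep T P a))
    (Primrec.list_sublists'.comp primrec_transStates) (Primrec.list_map (Primrec.const l)
      (Primrec.pair (Primrec.snd.comp Primrec.fst) ?_))
  refine Primrec.list_filter_rel
    (f := fun x : (List (S × A × S) × List S) × A => transStates x.1.1)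
    (R := fun x q => ∃ p ∈ x.1.2, (p, x.2, q) ∈ x.1.1)
    (primrec_transStates.comp (Primrec.fst.comp Primrec.fst)) ?_
  refine PrimrecPred.exists_mem
    (f := fun y : ((List (S × A × S) × List S) × A) × S => y.1.1.2)
    (R := fun y p => (p, y.1.2, y.2) ∈ y.1.1.1)
    (Primrec.snd.comp (Primrec.fst.comp Primrec.fst)) ?_
  exact PrimrecPred.mem (Primrec.fst.comp (Primrec.fst.comp (Primrec.fst.comp Primrec.fst)))
    (Primrec.pair Primrec.snd (Primrec.pair (Primrec.snd.comp (Primrec.fst.comp Primrec.fst))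
      (Primrec.snd.comp Primrec.fst)))

theorem primrecPred_isCompleteSet_behavior [Finite A] [Nonempty A] :
    PrimrecPred fun D : AutomatonCode A => IsCompleteSet D.behavior := by
  obtain ⟨l, hl⟩ := Finite.exists_univ_list A |>.imp fun l h => h.2
  refine (PrimrecPred.reflTransGen ((primrec_subsetEdges l).comp primrec_trimTrans)
    (primrec_transStates.comp primrec_trimTrans) (Primrec.const [])).not.of_eq fun D => ?_
  rw [reflTransGen_subsetEdges_iff hl, isCompleteSet_behavior_iff, not_exists]
  refine forall_congr' fun w => ?_
  rw [List.eq_nil_iff_forall_not_mem, not_forall_not]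
  simp only [mem_foldl_subsetStep]

end Completeness

/-! ### Product and reversed automata -/

section Product

variable {A S S' : Type*}

open Classical in
/-- The transitions of the automaton that reads `w` in the first and `w.map σ` in the second
component. -/
noncomputable def prodTrans (σ : A → A) (T : List (S × A × S)) (T' : List (S' × A × S')) :
    List ((S × S') × A × (S × S')) :=
  T.flatMap fun e => (T'.filter fun e' => e'.2.1 = σ e.2.1).map fun e' =>
    ((e.1, e'.1), e.2.1, (e.2.2, e'.2.2))

theorem mem_prodTrans {σ : A → A} {T : List (S × A × S)} {T' : List (S' × A × S')}
    {p q : S × S'} {a : A} :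
    (p, a, q) ∈ prodTrans σ T T' ↔ (p.1, a, q.1) ∈ T ∧ (p.2, σ a, q.2) ∈ T' := by
  simp only [prodTrans, List.mem_flatMap, List.mem_map, List.mem_filter, decide_eq_true_eq]
  constructor
  · rintro ⟨⟨p₁, b, q₁⟩, h, ⟨p₂, c, q₂⟩, ⟨h', rfl⟩, e⟩
    cases e
    exact ⟨h, h'⟩
  · rintro ⟨h, h'⟩
    exact ⟨_, h, _, ⟨h', rfl⟩, rfl⟩

theorem runs_prodTrans {σ : A → A} {T : List (S × A × S)} {T' : List (S' × A × S')}
    {p q : S × S'} {w : List A} :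
    Runs (prodTrans σ T T') p w q ↔ Runs T p.1 w q.1 ∧ Runs T' p.2 (w.map σ) q.2 := by
  induction w generalizing p with
  | nil => simp [Prod.ext_iff]
  | cons a w ih =>
    simp only [List.map_cons, runs_cons, ih, mem_prodTrans]
    exact ⟨fun ⟨r, ⟨h₁, h₂⟩, h₃, h₄⟩ => ⟨⟨r.1, h₁, h₃⟩, r.2, h₂, h₄⟩,
      fun ⟨⟨r₁, h₁, h₃⟩, r₂, h₂, h₄⟩ => ⟨(r₁, r₂), ⟨h₁, h₂⟩, h₃, h₄⟩⟩

theorem exists_runs_prodTrans_iff {σ : A → A} {T : List (S × A × S)} {T' : List (S' × A × S')}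
    {I F : List S} {I' F' : List S'} {w : List A} :
    (∃ x ∈ I.product I', ∃ y ∈ F.product F', Runs (prodTrans σ T T') x w y) ↔
      (∃ i ∈ I, ∃ t ∈ F, Runs T i w t) ∧ ∃ i ∈ I', ∃ t ∈ F', Runs T' i (w.map σ) t := by
  simp only [runs_prodTrans]
  constructor
  · rintro ⟨⟨i, i'⟩, hx, ⟨t, t'⟩, hy, h, h'⟩
    obtain ⟨hi, hi'⟩ := List.pair_mem_product.1 hx
    obtain ⟨ht, ht'⟩ := List.pair_mem_product.1 hy
    exact ⟨⟨i, hi, t, ht, h⟩, i', hi', t', ht', h'⟩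
  · rintro ⟨⟨i, hi, t, ht, h⟩, i', hi', t', ht', h'⟩
    exact ⟨(i, i'), List.pair_mem_product.2 ⟨hi, hi'⟩, (t, t'),
      List.pair_mem_product.2 ⟨ht, ht'⟩, h, h'⟩

/-- The reversed transitions. -/
def revTrans (T : List (S × A × S)) : List (S × A × S) := T.map fun e => (e.2.2, e.2.1, e.1)

theorem mem_revTrans {T : List (S × A × S)} {p q : S} {a : A} :
    (p, a, q) ∈ revTrans T ↔ (q, a, p) ∈ T := by
  simp only [revTrans, List.mem_map]
  constructor
  · rintro ⟨⟨_, _, _⟩, h, e⟩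
    cases e
    exact h
  · exact fun h => ⟨_, h, rfl⟩

theorem runs_revTrans {T : List (S × A × S)} {p q : S} {w : List A} :
    Runs (revTrans T) p w q ↔ Runs T q w.reverse p := by
  induction w generalizing p with
  | nil => simp [eq_comm]
  | cons a w ih =>
    simp only [List.reverse_cons, runs_append, runs_cons, runs_nil, ih, mem_revTrans]
    exact ⟨fun ⟨r, h, hr⟩ => ⟨r, hr, p, h, rfl⟩, fun ⟨r, hr, _, h, e⟩ => ⟨r, e ▸ h, hr⟩⟩

variable {α : Type*} [Primcodable α] [Primcodable A] [Primcodable S] [Primcodable S']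

theorem primrec_prodTrans [Finite A] (σ : A → A) {T : α → List (S × A × S)}
    {T' : α → List (S' × A × S')} (hT : Primrec T) (hT' : Primrec T') :
    Primrec fun x => prodTrans σ (T x) (T' x) := by
  classical
  refine Primrec.list_flatMap (g := fun x e => ((T' x).filter fun e' => e'.2.1 = σ e.2.1).map
    fun e' => ((e.1, e'.1), e.2.1, (e.2.2, e'.2.2))) hT ?_
  refine Primrec.list_map
    (f := fun y : α × (S × A × S) => (T' y.1).filter fun e' => e'.2.1 = σ y.2.2.1)
    (g := fun y e' => ((y.2.1, e'.1), y.2.2.1, (y.2.2.2, e'.2.2)))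
    (Primrec.list_filter_rel (R := fun (y : α × (S × A × S)) (e' : S' × A × S') =>
      e'.2.1 = σ y.2.2.1) (hT'.comp Primrec.fst) ?_) ?_
  · exact Primrec.eq.comp (Primrec.fst.comp (Primrec.snd.comp Primrec.snd))
      ((Primrec.dom_finite σ).comp (Primrec.fst.comp (Primrec.snd.comp
        (Primrec.snd.comp Primrec.fst))))
  · have h₁ : Primrec fun z : (α × (S × A × S)) × (S' × A × S') => z.1.2 :=
      Primrec.snd.comp Primrec.fst
    exact Primrec.pair (Primrec.pair (Primrec.fst.comp h₁) (Primrec.fst.comp Primrec.snd))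
      (Primrec.pair (Primrec.fst.comp (Primrec.snd.comp h₁))
        (Primrec.pair (Primrec.snd.comp (Primrec.snd.comp h₁))
          (Primrec.snd.comp (Primrec.snd.comp Primrec.snd))))

theorem primrec_revTrans : Primrec (revTrans : List (S × A × S) → List (S × A × S)) :=
  Primrec.list_map (g := fun _ (e : S × A × S) => (e.2.2, e.2.1, e.1)) Primrec.id
    (Primrec.pair (Primrec.snd.comp (Primrec.snd.comp Primrec.snd))
      (Primrec.pair (Primrec.fst.comp (Primrec.snd.comp Primrec.snd))
        (Primrec.fst.comp Primrec.snd)))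

end Product

/-! ### Detecting accepted words moved by a letter map, with or without reversal -/

section FixedWords

variable {A S : Type*}

theorem map_ne_self_iff {σ : A → A} {w : List A} :
    w.map σ ≠ w ↔ ∃ u a v, w = u ++ a :: v ∧ σ a ≠ a := by
  constructor
  · intro h
    by_contra! hcon
    refine h ((List.map_congr_left fun a ha => ?_).trans (List.map_id w))
    obtain ⟨u, v, rfl⟩ := List.append_of_mem ha
    exact hcon u a v rfl
  · rintro ⟨u, a, v, rfl, ha⟩ h
    rw [List.map_append] at h
    have := (List.append_inj h (by simp)).2
    rw [List.map_cons] at this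
    exact ha (List.cons.inj this).1

theorem exists_runs_map_ne_self_iff {σ : A → A} {T : List (S × A × S)} {I F : List S} :
    (∃ w, (∃ i ∈ I, ∃ t ∈ F, Runs T i w t) ∧ w.map σ ≠ w) ↔
      ∃ e ∈ T, σ e.2.1 ≠ e.2.1 ∧ (∃ i ∈ I, ∃ u, Runs T i u e.1) ∧
        ∃ t ∈ F, ∃ v, Runs T e.2.2 v t := by
  constructor
  · rintro ⟨w, ⟨i, hi, t, ht, hr⟩, hw⟩
    obtain ⟨u, a, v, rfl, ha⟩ := map_ne_self_iff.1 hw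
    obtain ⟨p, hu, q, he, hv⟩ := runs_append.1 hr
    exact ⟨_, he, ha, ⟨i, hi, u, hu⟩, t, ht, v, hv⟩
  · rintro ⟨⟨p, a, q⟩, he, ha, ⟨i, hi, u, hu⟩, t, ht, v, hv⟩
    exact ⟨u ++ a :: v, ⟨i, hi, t, ht, runs_append.2 ⟨p, hu, q, he, hv⟩⟩,
      map_ne_self_iff.2 ⟨u, a, v, rfl, ha⟩⟩

/-- Letters at mirror positions are compared. As `σ` need not be an involution, a mirror pair gives
two equations, either of which may fail; the second alternative is the middle letter. -/
theorem reverse_map_ne_self_iff {σ : A → A} {w : List A} :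
    (w.map σ).reverse ≠ w ↔
      (∃ u a m b v, u.length = v.length ∧ w = u ++ a :: (m ++ b :: v) ∧ (b ≠ σ a ∨ a ≠ σ b)) ∨
        ∃ u a v, u.length = v.length ∧ w = u ++ a :: v ∧ σ a ≠ a := by
  constructor
  · intro h
    induction w using List.bidirectionalRec with
    | nil => exact absurd rfl h
    | singleton a => exact .inr ⟨[], a, [], rfl, rfl, by simpa using h⟩
    | cons_append a l b ih =>
      by_cases hab : b ≠ σ a ∨ a ≠ σ b
      · exact .inl ⟨[], a, l, b, [], rfl, rfl, hab⟩
      simp only [ne_eq, not_or, not_not] at hab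
      have hl : (l.map σ).reverse ≠ l := by
        intro hl
        refine h ?_
        simp only [List.map_cons, List.map_append, List.map_nil, List.reverse_cons,
          List.reverse_append, List.reverse_nil, hl, ← hab.1, ← hab.2]
        simp
      rcases ih hl with ⟨u, c, m, d, v, huv, rfl, h'⟩ | ⟨u, c, v, huv, rfl, h'⟩
      · exact .inl ⟨a :: u, c, m, d, v ++ [b], by simp [huv], by simp, h'⟩
      · exact .inr ⟨a :: u, c, v ++ [b], by simp [huv], by simp, h'⟩
  · rintro (⟨u, a, m, b, v, huv, rfl, h'⟩ | ⟨u, a, v, huv, rfl, h'⟩) h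
    · have e₁ : (v.map σ).reverse ++ (σ b :: ((m.map σ).reverse ++ σ a :: (u.map σ).reverse)) =
          u ++ a :: (m ++ b :: v) := by simpa using h
      obtain ⟨-, e₂⟩ := List.append_inj e₁ (by simp [huv])
      obtain ⟨e₃, e₄⟩ := List.cons.inj e₂
      obtain ⟨-, e₅⟩ := List.append_inj e₄ (by simp)
      exact h'.elim (fun h => h (List.cons.inj e₅).1.symm) fun h => h e₃.symm
    · have e₁ : (v.map σ).reverse ++ (σ a :: (u.map σ).reverse) = u ++ a :: v := by
        simpa using h
      obtain ⟨-, e₂⟩ := List.append_inj e₁ (by simp [huv])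
      exact h' (List.cons.inj e₂).1

/-- The edges of the graph on pairs of states that reads a word from both ends. -/
def twoSidedEdges (T : List (S × A × S)) : List ((S × S) × (S × S)) :=
  T.flatMap fun e => T.map fun e' => ((e.1, e'.2.2), (e.2.2, e'.1))

theorem mem_twoSidedEdges {T : List (S × A × S)} {x y : S × S} :
    (x, y) ∈ twoSidedEdges T ↔ (∃ a, (x.1, a, y.1) ∈ T) ∧ ∃ b, (y.2, b, x.2) ∈ T := by
  simp only [twoSidedEdges, List.mem_flatMap, List.mem_map]
  constructor
  · rintro ⟨⟨p, a, q⟩, h, ⟨p', b, q'⟩, h', e⟩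
    cases e
    exact ⟨⟨a, h⟩, b, h'⟩
  · rintro ⟨⟨a, h⟩, b, h'⟩
    exact ⟨_, h, _, h', rfl⟩

/-- Each edge advances one letter from the left and retreats one from the right. The equal lengths
are what locate mirror positions. -/
theorem reflTransGen_twoSidedEdges_iff {T : List (S × A × S)} {x y : S × S} :
    Relation.ReflTransGen (fun x y => (x, y) ∈ twoSidedEdges T) x y ↔
      ∃ u v : List A, u.length = v.length ∧ Runs T x.1 u y.1 ∧ Runs T y.2 v x.2 := by
  constructor
  · intro h
    induction h with
    | refl => exact ⟨[], [], rfl, rfl, rfl⟩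
    | tail _ h ih =>
      obtain ⟨u, v, huv, hu, hv⟩ := ih
      obtain ⟨⟨a, ha⟩, b, hb⟩ := mem_twoSidedEdges.1 h
      exact ⟨u ++ [a], b :: v, by simp [huv], runs_append.2 ⟨_, hu, _, ha, rfl⟩, _, hb, hv⟩
  · rintro ⟨u, v, huv, hu, hv⟩
    induction v generalizing u y with
    | nil =>
      obtain rfl := List.length_eq_zero_iff.1 huv
      rw [show x = y from Prod.ext hu (Eq.symm hv)]
    | cons b v ih =>
      obtain ⟨u, a, rfl⟩ := List.eq_nil_or_concat u |>.resolve_left (by rintro rfl; simp at huv)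
      rw [List.concat_eq_append, runs_append] at hu
      obtain ⟨p, hu, q, ha, hq⟩ := hu
      obtain ⟨r, hb, hv⟩ := hv
      have hq : q = y.1 := hq
      subst hq
      exact (ih (y := (p, r)) u (by simpa using huv) hu hv).tail
        (mem_twoSidedEdges.2 ⟨⟨a, ha⟩, b, hb⟩)

theorem exists_runs_reverse_map_ne_self_iff {σ : A → A} {T : List (S × A × S)} {I F : List S} :
    (∃ w, (∃ i ∈ I, ∃ t ∈ F, Runs T i w t) ∧ (w.map σ).reverse ≠ w) ↔
      ∃ x ∈ I.product F, ∃ e ∈ T,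
        (∃ e' ∈ T, Relation.ReflTransGen (fun x y => (x, y) ∈ twoSidedEdges T) x (e.1, e'.2.2) ∧
          (∃ m, Runs T e.2.2 m e'.1) ∧ (e'.2.1 ≠ σ e.2.1 ∨ e.2.1 ≠ σ e'.2.1)) ∨
        (Relation.ReflTransGen (fun x y => (x, y) ∈ twoSidedEdges T) x (e.1, e.2.2) ∧
          σ e.2.1 ≠ e.2.1) := by
  simp only [reflTransGen_twoSidedEdges_iff]
  constructor
  · rintro ⟨w, ⟨i, hi, t, ht, hr⟩, hw⟩
    refine ⟨(i, t), List.pair_mem_product.2 ⟨hi, ht⟩, ?_⟩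
    rcases reverse_map_ne_self_iff.1 hw with ⟨u, a, m, b, v, huv, rfl, h⟩ | ⟨u, a, v, huv, rfl, h⟩
    · obtain ⟨p, hu, q, ha, hr⟩ := runs_append.1 hr
      obtain ⟨p', hm, q', hb, hv⟩ := runs_append.1 hr
      exact ⟨_, ha, .inl ⟨_, hb, ⟨u, v, huv, hu, hv⟩, ⟨m, hm⟩, h⟩⟩
    · obtain ⟨p, hu, q, ha, hv⟩ := runs_append.1 hr
      exact ⟨_, ha, .inr ⟨⟨u, v, huv, hu, hv⟩, h⟩⟩
  · rintro ⟨⟨i, t⟩, hx, ⟨p, a, q⟩, ha, h⟩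
    obtain ⟨hi, ht⟩ := List.pair_mem_product.1 hx
    rcases h with ⟨⟨p', b, q'⟩, hb, ⟨u, v, huv, hu, hv⟩, ⟨m, hm⟩, h⟩ | ⟨⟨u, v, huv, hu, hv⟩, h⟩
    · exact ⟨u ++ a :: (m ++ b :: v), ⟨i, hi, t, ht, runs_append.2 ⟨p, hu, q, ha,
        runs_append.2 ⟨p', hm, q', hb, hv⟩⟩⟩,
        reverse_map_ne_self_iff.2 (.inl ⟨u, a, m, b, v, huv, rfl, h⟩)⟩
    · exact ⟨u ++ a :: v, ⟨i, hi, t, ht, runs_append.2 ⟨p, hu, q, ha, hv⟩⟩,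
        reverse_map_ne_self_iff.2 (.inr ⟨u, a, v, huv, rfl, h⟩)⟩

theorem primrec_twoSidedEdges [Primcodable A] [Primcodable S] :
    Primrec (twoSidedEdges : List (S × A × S) → List ((S × S) × (S × S))) := by
  refine Primrec.list_flatMap (g := fun (T : List (S × A × S)) (e : S × A × S) =>
    T.map fun (e' : S × A × S) => ((e.1, e'.2.2), (e.2.2, e'.1)))
    Primrec.id (Primrec.list_map (f := fun y : List (S × A × S) × (S × A × S) => y.1)
      (g := fun y e' => ((y.2.1, e'.2.2), (y.2.2.2, e'.1))) Primrec.fst ?_)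
  have h₁ : Primrec fun z : (List (S × A × S) × (S × A × S)) × (S × A × S) => z.1.2 :=
    Primrec.snd.comp Primrec.fst
  exact Primrec.pair
    (Primrec.pair (Primrec.fst.comp h₁) (Primrec.snd.comp (Primrec.snd.comp Primrec.snd)))
    (Primrec.pair (Primrec.snd.comp (Primrec.snd.comp h₁)) (Primrec.fst.comp Primrec.snd))

variable {α : Type*} [Primcodable α] [Primcodable A] [Primcodable S] [Finite A]

theorem PrimrecPred.exists_runs_map_ne_self (σ : A → A) {T : α → List (S × A × S)}
    {I F : α → List S} (hT : Primrec T) (hI : Primrec I) (hF : Primrec F) :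
    PrimrecPred fun x => ∃ w, (∃ i ∈ I x, ∃ t ∈ F x, Runs (T x) i w t) ∧ w.map σ ≠ w := by
  have ha : Primrec fun y : α × (S × A × S) => y.2.2.1 :=
    Primrec.fst.comp (Primrec.snd.comp Primrec.snd)
  refine (PrimrecPred.exists_mem (R := fun x e => σ e.2.1 ≠ e.2.1 ∧
    (∃ i ∈ I x, ∃ u, Runs (T x) i u e.1) ∧ ∃ t ∈ F x, ∃ v, Runs (T x) e.2.2 v t) hT
    (PrimrecPred.and ?_ (PrimrecPred.and ?_ ?_))).of_eq fun x =>
      exists_runs_map_ne_self_iff.symm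
  · exact (Primrec.eq.comp ((Primrec.dom_finite σ).comp ha) ha).not
  · exact PrimrecPred.exists_runs_from (hT.comp Primrec.fst) (hI.comp Primrec.fst)
      (Primrec.fst.comp Primrec.snd)
  · exact PrimrecPred.exists_runs_to (hT.comp Primrec.fst) (hF.comp Primrec.fst)
      (Primrec.snd.comp (Primrec.snd.comp Primrec.snd))

theorem PrimrecPred.exists_runs_reverse_map_ne_self (σ : A → A) {T : α → List (S × A × S)}
    {I F : α → List S} (hT : Primrec T) (hI : Primrec I) (hF : Primrec F) :
    PrimrecPred fun x =>
      ∃ w, (∃ i ∈ I x, ∃ t ∈ F x, Runs (T x) i w t) ∧ (w.map σ).reverse ≠ w := by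
  have hσ := Primrec.dom_finite σ
  refine (PrimrecPred.exists_mem (f := fun x => (I x).product (F x))
    (R := fun x s => ∃ e ∈ T x,
      (∃ e' ∈ T x, Relation.ReflTransGen (fun a b => (a, b) ∈ twoSidedEdges (T x)) s
        (e.1, e'.2.2) ∧ (∃ m, Runs (T x) e.2.2 m e'.1) ∧
          (e'.2.1 ≠ σ e.2.1 ∨ e.2.1 ≠ σ e'.2.1)) ∨
      (Relation.ReflTransGen (fun a b => (a, b) ∈ twoSidedEdges (T x)) s (e.1, e.2.2) ∧
        σ e.2.1 ≠ e.2.1)) (Primrec.list_product hI hF) ?_).of_eq fun x =>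
      exists_runs_reverse_map_ne_self_iff.symm
  refine PrimrecPred.exists_mem (f := fun y : α × (S × S) => T y.1) (R := fun y e =>
      (∃ e' ∈ T y.1, Relation.ReflTransGen (fun a b => (a, b) ∈ twoSidedEdges (T y.1)) y.2
        (e.1, e'.2.2) ∧ (∃ m, Runs (T y.1) e.2.2 m e'.1) ∧
          (e'.2.1 ≠ σ e.2.1 ∨ e.2.1 ≠ σ e'.2.1)) ∨
      (Relation.ReflTransGen (fun a b => (a, b) ∈ twoSidedEdges (T y.1)) y.2 (e.1, e.2.2) ∧
        σ e.2.1 ≠ e.2.1)) (hT.comp Primrec.fst) (PrimrecPred.or ?_ (PrimrecPred.and ?_ ?_))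
  · refine PrimrecPred.exists_mem (f := fun z : (α × (S × S)) × (S × A × S) => T z.1.1)
      (R := fun z e' => Relation.ReflTransGen (fun a b => (a, b) ∈ twoSidedEdges (T z.1.1)) z.1.2
        (z.2.1, e'.2.2) ∧ (∃ m, Runs (T z.1.1) z.2.2.2 m e'.1) ∧
          (e'.2.1 ≠ σ z.2.2.1 ∨ z.2.2.1 ≠ σ e'.2.1)) (hT.comp (Primrec.fst.comp Primrec.fst)) ?_
    have h₁ : Primrec fun z : ((α × (S × S)) × (S × A × S)) × (S × A × S) => T z.1.1.1 :=
      hT.comp (Primrec.fst.comp (Primrec.fst.comp Primrec.fst))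
    have h₂ : Primrec fun z : ((α × (S × S)) × (S × A × S)) × (S × A × S) => z.1.2 :=
      Primrec.snd.comp Primrec.fst
    have ha := Primrec.fst.comp (Primrec.snd.comp h₂)
    have hb : Primrec fun z : ((α × (S × S)) × (S × A × S)) × (S × A × S) => z.2.2.1 :=
      Primrec.fst.comp (Primrec.snd.comp Primrec.snd)
    refine PrimrecPred.and ?_ (PrimrecPred.and ?_ (PrimrecPred.or ?_ ?_))
    · exact PrimrecPred.reflTransGen (primrec_twoSidedEdges.comp h₁)
        (Primrec.snd.comp (Primrec.fst.comp Primrec.fst))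
        (Primrec.pair (Primrec.fst.comp h₂) (Primrec.snd.comp (Primrec.snd.comp Primrec.snd)))
    · exact PrimrecPred.exists_runs h₁ (Primrec.snd.comp (Primrec.snd.comp h₂))
        (Primrec.fst.comp Primrec.snd)
    · exact (Primrec.eq.comp hb (hσ.comp ha)).not
    · exact (Primrec.eq.comp ha (hσ.comp hb)).not
  · exact PrimrecPred.reflTransGen
      (primrec_twoSidedEdges.comp (hT.comp (Primrec.fst.comp Primrec.fst)))
      (Primrec.snd.comp Primrec.fst)
      (Primrec.pair (Primrec.fst.comp Primrec.snd)
        (Primrec.snd.comp (Primrec.snd.comp Primrec.snd)))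
  · have ha : Primrec fun z : (α × (S × S)) × (S × A × S) => z.2.2.1 :=
      Primrec.fst.comp (Primrec.snd.comp Primrec.snd)
    exact (Primrec.eq.comp (hσ.comp ha) ha).not

end FixedWords

/-! ### The form of `θ` and deciding independence -/

section Independence

variable {A : Type*}

theorem length_le_length_of_injective {θ : List A → List A} (h₁ : Function.Injective θ)
    (h₂ : ∀ u v, θ (u ++ v) = θ u ++ θ v) (w : List A) : w.length ≤ (θ w).length := by
  have h0 : θ [] = [] := by simpa using h₂ [] []
  induction w with
  | nil => simp
  | cons a w ih =>
    have ha : θ [a] ≠ [] := fun h => by simpa using h₁ (h.trans h0.symm)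
    have := List.length_pos_iff.2 ha
    rw [← List.singleton_append, h₂, List.length_append, List.length_append,
      List.length_singleton]
    omega

/-- Neither `θ` nor its inverse shortens words, since injectivity forbids erasing a letter. Hence
letters go to letters. -/
theorem IsAutomorphism.exists_eq_map {θ : List A → List A} (hθ : IsAutomorphism θ) :
    ∃ σ : A → A, ∀ w, θ w = w.map σ := by
  obtain ⟨hb, hm⟩ := hθ
  have h0 : θ [] = [] := by simpa using hm [] []
  obtain ⟨g, hg₁, hg₂⟩ := Function.bijective_iff_has_inverse.1 hb
  have hgm : ∀ u v, g (u ++ v) = g u ++ g v := fun u v => hb.1 (by rw [hm, hg₂, hg₂, hg₂])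
  have hlet : ∀ a, ∃ b, θ [a] = [b] := fun a => by
    have h₁ := length_le_length_of_injective hb.1 hm [a]
    have h₂ := length_le_length_of_injective hg₂.injective hgm (θ [a])
    rw [hg₁] at h₂
    exact List.length_eq_one_iff.1 (le_antisymm h₂ h₁)
  choose σ hσ using hlet
  refine ⟨σ, fun w => ?_⟩
  induction w with
  | nil => exact h0
  | cons a w ih => rw [← List.singleton_append, hm, hσ, ih]; rfl

theorem IsAntiAutomorphism.exists_eq_reverse_map {θ : List A → List A}
    (hθ : IsAntiAutomorphism θ) : ∃ σ : A → A, ∀ w, θ w = (w.map σ).reverse := by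
  have h : IsAutomorphism fun w => (θ w).reverse :=
    ⟨List.reverse_bijective.comp hθ.1, fun u v => by simp [hθ.2]⟩
  obtain ⟨σ, hσ⟩ := h.exists_eq_map
  exact ⟨σ, fun w => by rw [← hσ, List.reverse_reverse]⟩

variable [Finite A] [Primcodable A]

/-- A violation is a word `w` with `w` and `θ w` both in the set and `θ w ≠ w`. A product automaton
recognizes the first two requirements, and the third is tested on its runs. -/
theorem primrecPred_isIndependent_behavior {θ : List A → List A}
    (hθ : IsAutomorphism θ ∨ IsAntiAutomorphism θ) :
    PrimrecPred fun D : AutomatonCode A =>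
      IsIndependent (antiReflRestr (Function.graph θ)) D.behavior := by
  have hT : Primrec fun D : AutomatonCode A => D.1 := Primrec.fst
  have hI : Primrec fun D : AutomatonCode A => D.2.1 := Primrec.fst.comp Primrec.snd
  have hF : Primrec fun D : AutomatonCode A => D.2.2 := Primrec.snd.comp Primrec.snd
  rcases hθ with hθ | hθ
  · obtain ⟨σ, hσ⟩ := hθ.exists_eq_map
    refine (PrimrecPred.exists_runs_map_ne_self σ (primrec_prodTrans σ hT hT)
      (Primrec.list_product hI hI) (Primrec.list_product hF hF)).not.of_eq fun D => ?_
    refine Iff.trans ?_ isIndependent_antiReflRestr_graph_iff.symm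
    rw [not_exists]
    refine forall_congr' fun w => ?_
    rw [exists_runs_prodTrans_iff, ← AutomatonCode.mem_behavior_iff,
      ← AutomatonCode.mem_behavior_iff, hσ]
    tauto
  · obtain ⟨σ, hσ⟩ := hθ.exists_eq_reverse_map
    -- The second component runs backwards, so its initial and terminal states are exchanged.
    refine (PrimrecPred.exists_runs_reverse_map_ne_self σ
      (primrec_prodTrans σ hT (primrec_revTrans.comp hT))
      (Primrec.list_product hI hF) (Primrec.list_product hF hI)).not.of_eq fun D => ?_
    refine Iff.trans ?_ isIndependent_antiReflRestr_graph_iff.symm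
    rw [not_exists]
    refine forall_congr' fun w => ?_
    have hrev : (∃ t ∈ D.2.2, ∃ i ∈ D.2.1, Runs (revTrans D.1) t (w.map σ) i) ↔
        (w.map σ).reverse ∈ D.behavior := by
      simp only [AutomatonCode.mem_behavior_iff, runs_revTrans]
      exact ⟨fun ⟨t, ht, i, hi, h⟩ => ⟨i, hi, t, ht, h⟩, fun ⟨i, hi, t, ht, h⟩ => ⟨t, ht, i, hi, h⟩⟩
    rw [exists_runs_prodTrans_iff, ← AutomatonCode.mem_behavior_iff, hrev, hσ]
    tauto

end Independence

/-! ### Equivalence of maximality, completeness and measure 1 -/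

section Main

variable {A : Type*}

theorem isIndependent_antiReflRestr_graph_id (X : Set (List A)) :
    IsIndependent (antiReflRestr (Function.graph id)) X :=
  isIndependent_antiReflRestr_graph_iff.2 fun _ _ _ => rfl

theorem isAutomorphism_id : IsAutomorphism (id : List A → List A) :=
  ⟨Function.bijective_id, fun _ _ => rfl⟩

variable [Fintype A] [Nontrivial A]

theorem IsCode.isMaximalIndependentCode_of_uniformMeasure_eq_one {X : Set (List A)}
    (hX : IsCode X) (h : uniformMeasure X = 1) {τ : SetRel (List A) (List A)}
    (hi : IsIndependent τ X) : IsMaximalIndependentCode τ X :=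
  ⟨⟨hX, hi⟩, fun _ hY hXY => (hY.1.eq_of_uniformMeasure_eq_one hXY h).ge⟩

theorem isCompleteSet_iff_uniformMeasure_eq_one {X : Language A} (hr : X.IsRegular)
    (hX : IsCode X) : IsCompleteSet X ↔ uniformMeasure X = 1 :=
  ⟨fun h => (uniformMeasure_le_one_of_isCode hX).antisymm
    (one_le_uniformMeasure_of_isCompleteSet hr h),
   -- With `θ = id` every set is independent, so maximality is that of plain codes.
   fun h => isCompleteSet_of_isMaximalIndependentCode (.inl isAutomorphism_id)
    (hX.isMaximalIndependentCode_of_uniformMeasure_eq_one h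
      (isIndependent_antiReflRestr_graph_id X))⟩

theorem isMaximalIndependentCode_iff_isCompleteSet {θ : List A → List A}
    (hθ : IsAutomorphism θ ∨ IsAntiAutomorphism θ) {X : Language A} (hr : X.IsRegular)
    (hX : IsCode X) (hi : IsIndependent (antiReflRestr (Function.graph θ)) X) :
    IsMaximalIndependentCode (antiReflRestr (Function.graph θ)) X ↔ IsCompleteSet X :=
  ⟨isCompleteSet_of_isMaximalIndependentCode hθ, fun h =>
    hX.isMaximalIndependentCode_of_uniformMeasure_eq_one
      ((isCompleteSet_iff_uniformMeasure_eq_one hr hX).1 h) hi⟩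

end Main

theorem mainTheorem11 {A : Type*} [Fintype A] [Primcodable A] (hA : 2 ≤ Fintype.card A)
    (θ : List A → List A) (hθ : IsAutomorphism θ ∨ IsAntiAutomorphism θ) :
    (∀ X : Language A, X.IsRegular → IsCode X →
      (IsCompleteSet X ↔ uniformMeasure X = 1) ∧
      (IsIndependent (antiReflRestr (Function.graph θ)) X →
        List.TFAE [IsMaximalIndependentCode (antiReflRestr (Function.graph θ)) X,
          IsCompleteSet X, uniformMeasure X = 1])) ∧
    (∃ f : AutomatonCode A → Bool, Computable f ∧
      ∀ D : AutomatonCode A, IsCode D.behavior →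
        (f D = true ↔ CondC3 (reflClosure (Function.graph θ)) D.behavior)) ∧
    (∀ X : Language A, X.IsRegular → IsCode X →
      IsIndependent (antiReflRestr (Function.graph θ)) X →
        ∃ Y : Language A, X ≤ Y ∧
          IsMaximalIndependentCode (antiReflRestr (Function.graph θ)) Y) := by
  classical
  have : Nontrivial A := Fintype.one_lt_card_iff_nontrivial.1 hA
  refine ⟨fun X hr hX => ?_, ?_, fun X _ hX hi => exists_isMaximalIndependentCode _ hX hi⟩
  · have h := isCompleteSet_iff_uniformMeasure_eq_one hr hX
    refine ⟨h, fun hi => ?_⟩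
    tfae_have 1 ↔ 2 := isMaximalIndependentCode_iff_isCompleteSet hθ hr hX hi
    tfae_have 2 ↔ 3 := h
    tfae_finish
  -- The procedure tests independence and completeness; the promise that the input is a code makes
  -- this equivalent to (c3).
  · refine ⟨_, ((primrecPred_isIndependent_behavior hθ).and
      primrecPred_isCompleteSet_behavior).decide.to_comp, fun D hD => ?_⟩
    rw [decide_eq_true_iff]
    change _ ↔ IsMaximalIndependentCode (antiReflRestr (reflClosure _)) _
    rw [antiReflRestr_reflClosure]
    constructor
    · rintro ⟨hi, hc⟩
      exact (isMaximalIndependentCode_iff_isCompleteSet hθ D.behavior_isRegular hD hi).2 hc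
    · intro h
      exact ⟨h.prop.2, isCompleteSet_of_isMaximalIndependentCode hθ h⟩
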